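/- Let $q$ be a power of a prime, $K=\mathbb F_{q^2}$, $A=K[x,y]$, $H=x^{q+1}-y^q-y$, and let $E$ be the set of the $q^3$ $K$-rational points of the affine Hermitian curve $\mathcal H:\ H=0$. Give $x^ry^s$ the weight $w(x^ry^s)=rq+s(q+1)$. For an integer $m\ge 0$ the Hermitian code $C_m\subseteq K^E$ is the dual of the code of the vectors $(f(P))_{P\in E}$, where $f$ runs through the span of the monomials of weight at most $m$. For $D\subseteq\mathbb A^2(K)$ let $I_D\subseteq A$ be the ideal of the polynomials vanishing on $D$; $D$ is the complete intersection of the plane curves $F=0$ and $G=0$ ($F,G\in A$ non-constant) if $I_D=\langle F,G\rangle$. Leading monomials $\mathrm{LM}$ are taken for the degree reverse lexicographic order with $y>x$. Let $\Lambda\subset\mathbb Z$ be the semigroup (with $0$) generated by $q$ and $q+1$, let $\Lambda_{\mathcal B}$ be the set of weights of the monomials $x^ry^s$ with $0\le r\le q,\ 0\le s\le q^2-q-1$ or with $r=0,\ q^2-q\le s\le q^2-1$, and let $\delta(m)=m-(q-2)(q+1)$. **Theorem A.** For every $m\geq 0$, the support $D\subseteq E$ of every minimum-weight (nonzero) codeword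 of $C_m$ is a complete intersection of two plane curves. More precisely, let $m+1\in\Lambda_{\mathcal B}$ (every nonzero Hermitian code $C_m$ has such a label $m$). Then: 1. If $m\le q^2-2$, there is $h$ with $1\le h\le q-1$ and $hq\le m+1\le h(q+1)$ such that $D$ is the complete intersection either of a vertical line $x=u$ and a union of $h+1$ distinct horizontal lines, or, and this only if $m+1=hq$, of a line $y=ux+v$ with $(u,v)\ne(0,0)$ and a union of $h+1$ distinct vertical lines (all lines defined over $K$). 2. If $m\ge q^2-q-1$ and $\delta(m)\in\Lambda$ (in particular whenever $m\ge 2q^2-2q-2$), write $\delta(m)=\mu q+\lambda(q+1)$ with $0\le\mu\le q$, $\lambda\ge 0$. Then $D$ is the complete intersection of $\mathcal H$ and a curve $F=0$ with $\mathrm{LM}(F)=x^\mu y^\lambda$. 3. If $m\ge q^2-q-1$ and $\delta(m)\notin\Lambda$, write $\delta(m)=(\mu-1)(q+1)+t$ with $1\le\mu\le q-1$ and $1\le t\le q-\mu$. Then $D$ is the complete intersection either of $\mathcal H$ and a curve $F=0$ with $\mathrm{LM}(F)=x^\mu$, or, and this only if $t=1$, of two curves $F_1=0$ and $F_2=0$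 with $\mathrm{LM}(F_1)=x^q$ and $\mathrm{LM}(F_2)=y^\mu$. -/

import Mathlib

noncomputable section

namespace HermitianCode

open MvPolynomial

/-- The coordinate `x` of the affine plane. -/
abbrev x (K : Type*) [Field K] : MvPolynomial (Fin 2) K := X 0

/-- The coordinate `y` of the affine plane. -/
abbrev y (K : Type*) [Field K] : MvPolynomial (Fin 2) K := X 1

/-- The polynomial `H = x ^ (q + 1) - y ^ q - y` of the affine Hermitian curve. -/
def hermitianPoly (q : ℕ) (K : Type*) [Field K] : MvPolynomial (Fin 2) K :=
  x K ^ (q + 1) - y K ^ q - y K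

/-- The `K`-rational points of the affine Hermitian curve (later `K` has `q ^ 2` elements). -/
abbrev Point (q : ℕ) (K : Type*) [Field K] : Type _ :=
  {P : Fin 2 → K // eval P (hermitianPoly q K) = 0}

instance (q : ℕ) (K : Type*) [Field K] [Fintype K] [DecidableEq K] : Fintype (Point q K) :=
  Subtype.fintype _

/-- The weighted degree of `x ^ r * y ^ s` for the weight vector `[q, q + 1]`. -/
def wDeg (q r s : ℕ) : ℕ := r * q + s * (q + 1)

/-- The vector of values of a polynomial at the rational points of the Hermitian curve. -/
def evalPoints (q : ℕ) (K : Type*) [Field K] : MvPolynomial (Fin 2) K →ₗ[K] (Point q K → K) where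
  toFun f := fun P => eval P.1 f
  map_add' f g := by ext P; simp
  map_smul' a f := by ext P; simp

/-- The evaluation code of the space spanned by the monomials of weighted degree at most `m`. -/
def evalCode (q : ℕ) (K : Type*) [Field K] (m : ℕ) : Submodule K (Point q K → K) :=
  (Submodule.span K {f | ∃ r s : ℕ, wDeg q r s ≤ m ∧ f = x K ^ r * y K ^ s}).map (evalPoints q K)

/-- The Hermitian code `C_m`: the dual of the evaluation code. -/
def code (q : ℕ) (K : Type*) [Field K] [Fintype K] [DecidableEq K] (m : ℕ) :
    Submodule K (Point q K → K) where
  carrier := {c | ∀ v ∈ evalCode q K m, ∑ P, v P * c P = 0}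
  zero_mem' := by intro v _; simp
  add_mem' := by
    intro a b ha hb v hv
    simp only [Pi.add_apply, mul_add, Finset.sum_add_distrib, ha v hv, hb v hv, add_zero]
  smul_mem' := by
    intro t a ha v hv
    have h := ha v hv
    simp only [Pi.smul_apply, smul_eq_mul, mul_left_comm _ t, ← Finset.mul_sum, h, mul_zero]

/-- `c` is a nonzero element of the code `C`, of minimum Hamming weight among those. -/
def IsMinWeight {ι K : Type*} [Fintype ι] [Field K] [DecidableEq K] (C : Submodule K (ι → K))
    (c : ι → K) : Prop :=
  c ∈ C ∧ c ≠ 0 ∧ ∀ c' ∈ C, c' ≠ 0 → hammingNorm c ≤ hammingNorm c'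

/-- The support of a word, as a set of points of the affine plane. -/
def support {q : ℕ} {K : Type*} [Field K] (c : Point q K → K) : Set (Fin 2 → K) :=
  Subtype.val '' Function.support c

/-- `D` (with its reduced structure) is the scheme-theoretic intersection of the two affine plane
curves `F = 0` and `G = 0`: these polynomials generate the ideal of all polynomials that vanish
on `D`. -/
def IsIntersection {K : Type*} [Field K] (D : Set (Fin 2 → K)) (F G : MvPolynomial (Fin 2) K) :
    Prop :=
  F.totalDegree ≠ 0 ∧ G.totalDegree ≠ 0 ∧ vanishingIdeal K D = Ideal.span {F, G}

/-- `D` is a complete intersection of two affine plane curves. -/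
def IsCompleteIntersection {K : Type*} [Field K] (D : Set (Fin 2 → K)) : Prop :=
  ∃ F G : MvPolynomial (Fin 2) K, IsIntersection D F G

/-- The strict degree reverse lexicographic order with `y > x` on monomials: `a` stands for the
monomial `x ^ a 0 * y ^ a 1`. -/
def MonLT (a b : Fin 2 →₀ ℕ) : Prop :=
  a 0 + a 1 < b 0 + b 1 ∨ (a 0 + a 1 = b 0 + b 1 ∧ b 0 < a 0)

/-- The leading monomial of `F` is `x ^ r * y ^ s`. -/
def HasLeadingMonomial {K : Type*} [Field K] (F : MvPolynomial (Fin 2) K) (r s : ℕ) : Prop :=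
  ∃ a ∈ F.support, a 0 = r ∧ a 1 = s ∧ ∀ b ∈ F.support, b ≠ a → MonLT b a

/-- The semigroup generated by `q` and `q + 1`, inside the integers. -/
def Lam (q : ℕ) : AddSubmonoid ℤ := AddSubmonoid.closure {(q : ℤ), (q : ℤ) + 1}

/-- The weighted degrees of the monomials `x ^ r * y ^ s` with `r ≤ q` and `s < q ^ 2 - q`, or with
`r = 0` and `q ^ 2 - q ≤ s < q ^ 2`. -/
def LamB (q : ℕ) : Set ℕ :=
  {n | ∃ r s : ℕ, ((r ≤ q ∧ s + q < q ^ 2) ∨ (r = 0 ∧ q ^ 2 ≤ s + q ∧ s < q ^ 2)) ∧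
    n = wDeg q r s}

/-- The integer `δ(m) = m - (q - 2) * (q + 1)`. -/
def delta (q m : ℕ) : ℤ := (m : ℤ) - ((q : ℤ) - 2) * ((q : ℤ) + 1)

end HermitianCode

end

/-! Order polynomials by weighted degree. Modulo `H` each monomial can be replaced, up to smaller
weights, by the unique monomial of the same weight with `x`-exponent at most `q` (`exists_reduced`,
`eq_of_wt_eq`). For a set `D` of curve points, the reduced monomials that do not lead a polynomial
vanishing on `D` form its `footprint`; they are a basis of the functions on `D`, so there are `|D|`
of them (`ncard_footprint`). By linear algebra, the supports of minimum-weight words of `C_m` are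
smallest sets `D` whose footprint contains some `a` of weight at least `m + 1`
(`IsMinWeight.isMinimalSupport`).

With `a`, the footprint contains every reduced `b` such that `wt a - wt b` lies in the semigroup `Λ`
(`mem_footprint_of_wt_add`). Counting these divisors of `a` bounds `|D|` from below
(`card_boxes_le_ncard`), in particular by the Goppa bound `wt a + 1 - 2g` with `2g = q ^ 2 - q`
(`wt_le_ncard`). Explicit point sets on vertical and horizontal lines bound `|D|` from above
(`exists_on_vertical_line`, `exists_of_lines`). Comparing the bounds leaves few possibilities for
`a`, and forces the footprint to be exactly the set of divisors of `a`.

The ideal can then be read off. If the footprint is a rectangle, two polynomials led by `x ^ r` and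
`y ^ s` generate it (`vanishingIdeal_eq_of_monomials`). If the Goppa bound is attained, with `|D| =
d`, the symmetry of `Λ` shows that the weights of reduced monomials outside the footprint are those
in `d + Λ`, so `H` and one polynomial of leading weight `d` generate it
(`exists_vanishingIdeal_eq_span_hermitianPoly`). -/

namespace HermitianCode

open MvPolynomial

/-! ### Weighted degree and reduction modulo `H`. -/

section Monomials

/-- The weighted degree of an exponent. -/
def wt (q : ℕ) (a : Fin 2 →₀ ℕ) : ℕ := wDeg q (a 0) (a 1)

theorem wt_add (q : ℕ) (a b : Fin 2 →₀ ℕ) : wt q (a + b) = wt q a + wt q b := by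
  simp only [wt, wDeg, Finsupp.add_apply]; ring

/-- The exponent of the monomial `x ^ r * y ^ s`. -/
noncomputable def expo (r s : ℕ) : Fin 2 →₀ ℕ := Finsupp.single 0 r + Finsupp.single 1 s

@[simp] theorem expo_zero (r s : ℕ) : expo r s 0 = r := by simp [expo]

@[simp] theorem expo_one (r s : ℕ) : expo r s 1 = s := by simp [expo]

theorem expo_eta (a : Fin 2 →₀ ℕ) : expo (a 0) (a 1) = a := by
  ext i; fin_cases i <;> simp

theorem expo_add (r s r' s' : ℕ) : expo r s + expo r' s' = expo (r + r') (s + s') := by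
  ext i; fin_cases i <;> simp

theorem exponent_ext {a b : Fin 2 →₀ ℕ} (h0 : a 0 = b 0) (h1 : a 1 = b 1) : a = b := by
  rw [← expo_eta a, ← expo_eta b, h0, h1]

@[simp] theorem wt_expo (q r s : ℕ) : wt q (expo r s) = r * q + s * (q + 1) := by
  simp [wt, wDeg]

theorem wt_eq (q : ℕ) (a : Fin 2 →₀ ℕ) : wt q a = a 0 * q + a 1 * (q + 1) := rfl

/-- Modulo `q + 1` the weight is minus the `x`-exponent, which therefore is determined in the range
from `0` to `q`. -/
theorem eq_of_wt_eq {q : ℕ} {a b : Fin 2 →₀ ℕ} (ha : a 0 ≤ q) (hb : b 0 ≤ q)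
    (h : wt q a = wt q b) : a = b := by
  rw [wt_eq, wt_eq] at h
  have key : ∀ r s r' s' : ℕ, r ≤ q → r' ≤ q → r * q + s * (q + 1) = r' * q + s' * (q + 1) →
      r' ≤ r := by
    intro r s r' s' hr hr' h
    by_contra! hlt
    have h1 : ((q : ℤ) + 1) ∣ ((r' : ℤ) - r) := by
      refine ⟨(r' + s' : ℤ) - (r + s), ?_⟩
      zify at h
      linarith
    have := Int.le_of_dvd (by omega) h1
    omega
  have h0 : a 0 = b 0 := le_antisymm (key _ _ _ _ hb ha h.symm) (key _ _ _ _ ha hb h)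
  refine exponent_ext h0 ?_
  rw [h0] at h
  exact Nat.eq_of_mul_eq_mul_right (Nat.succ_pos q) (Nat.add_left_cancel h)

variable {K : Type*} [Field K]

theorem monomial_expo (r s : ℕ) : monomial (expo r s) (1 : K) = x K ^ r * y K ^ s := by
  rw [expo, x, y, X_pow_eq_monomial, X_pow_eq_monomial, monomial_mul, one_mul]

theorem monomial_mul_one (a b : Fin 2 →₀ ℕ) :
    monomial (a + b) (1 : K) = monomial a 1 * monomial b 1 := by
  rw [monomial_mul, one_mul]

/-- The polynomials whose monomials all have weighted degree less than `k`. -/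
noncomputable def below (q : ℕ) (K : Type*) [Field K] (k : ℕ) :
    Submodule K (MvPolynomial (Fin 2) K) :=
  restrictSupport K {a | wt q a < k}

/-- The polynomials of degree at most `q` in `x`, whose monomials all have weighted degree less
than `k`. -/
noncomputable def low (q : ℕ) (K : Type*) [Field K] (k : ℕ) :
    Submodule K (MvPolynomial (Fin 2) K) :=
  restrictSupport K {a | a 0 ≤ q ∧ wt q a < k}

theorem low_le_below (q k : ℕ) : low q K k ≤ below q K k :=
  restrictSupport_mono _ fun _ ha => ha.2

theorem low_mono (q : ℕ) {k l : ℕ} (h : k ≤ l) : low q K k ≤ low q K l :=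
  restrictSupport_mono _ fun _ ha => ⟨ha.1, ha.2.trans_le h⟩

theorem below_mono (q : ℕ) {k l : ℕ} (h : k ≤ l) : below q K k ≤ below q K l :=
  restrictSupport_mono _ fun _ ha => lt_of_lt_of_le ha h

theorem monomial_mem_below {q k : ℕ} {a : Fin 2 →₀ ℕ} (h : wt q a < k) (c : K) :
    monomial a c ∈ below q K k :=
  (monomial_mem_restrictSupport K).2 (Or.inl h)

theorem monomial_mem_low {q k : ℕ} {a : Fin 2 →₀ ℕ} (h0 : a 0 ≤ q) (h : wt q a < k) (c : K) :
    monomial a c ∈ low q K k :=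
  (monomial_mem_restrictSupport K).2 (Or.inl ⟨h0, h⟩)

theorem mul_monomial_mem_below {q k : ℕ} {f : MvPolynomial (Fin 2) K} (hf : f ∈ below q K k)
    (b : Fin 2 →₀ ℕ) : f * monomial b 1 ∈ below q K (k + wt q b) := by
  have h : monomial b (1 : K) ∈ restrictSupport K {b} :=
    (monomial_mem_restrictSupport K).2 (Or.inl rfl)
  have := Submodule.mul_mem_mul hf h
  rw [below, ← restrictSupport_add] at this
  refine restrictSupport_mono _ ?_ this
  rintro _ ⟨a, ha, _, rfl, rfl⟩
  simpa [wt_add] using ha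

/-- To place a polynomial in a submodule it is enough to place its monomials there. -/
theorem restrictSupport_le {S : Set (Fin 2 →₀ ℕ)} {W : Submodule K (MvPolynomial (Fin 2) K)}
    (h : ∀ a ∈ S, monomial a 1 ∈ W) : restrictSupport K S ≤ W := by
  rw [restrictSupport_eq_span, Submodule.span_le]
  rintro _ ⟨a, ha, rfl⟩
  exact h a ha

/-- Reduction of a monomial modulo the equation of the Hermitian curve. -/
theorem exists_reduced {q : ℕ} (hq : 2 ≤ q) {J : Ideal (MvPolynomial (Fin 2) K)}
    (hJ : hermitianPoly q K ∈ J) (b : Fin 2 →₀ ℕ) :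
    ∃ a : Fin 2 →₀ ℕ, a 0 ≤ q ∧ wt q a = wt q b ∧
      monomial b 1 - monomial a 1 ∈ J.restrictScalars K ⊔ low q K (wt q b) := by
  induction hn : b 0 using Nat.strong_induction_on generalizing b with
  | _ n ih =>
    by_cases hb : b 0 ≤ q
    · exact ⟨b, hb, rfl, by simp⟩
    obtain ⟨r, hr⟩ : ∃ r, b 0 = r + (q + 1) := ⟨b 0 - (q + 1), by omega⟩
    have hbe : b = expo (r + (q + 1)) (b 1) := by rw [← hr, expo_eta]
    set s := b 1
    -- In `x ^ (q + 1) = y ^ q + y` the term `y ^ q` has the weight of the left side and `y` a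
    -- smaller one. Both lower the `x`-exponent, on which the induction runs.
    obtain ⟨a, ha, hwa, hma⟩ := ih r (by omega) (expo r (s + q)) (by simp)
    obtain ⟨a', ha', hwa', hma'⟩ := ih r (by omega) (expo r (s + 1)) (by simp)
    have h1 : wt q (expo r (s + q)) = wt q b := by
      rw [hbe, wt_expo, wt_expo]; ring
    have h2 : wt q (expo r (s + 1)) < wt q b := by
      rw [← h1, wt_expo, wt_expo]; nlinarith
    refine ⟨a, ha, hwa.trans h1, ?_⟩
    rw [h1] at hma
    have h3 : monomial a' (1 : K) ∈ J.restrictScalars K ⊔ low q K (wt q b) :=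
      Submodule.mem_sup_right (monomial_mem_low ha' (by omega) 1)
    have h4 := sup_le_sup_left (low_mono (K := K) q h2.le) (J.restrictScalars K) hma'
    have h5 : monomial (expo r s) (1 : K) * hermitianPoly q K ∈
        J.restrictScalars K ⊔ low q K (wt q b) :=
      Submodule.mem_sup_left (J.mul_mem_left _ hJ)
    have key : monomial b (1 : K) - monomial a 1 =
        monomial (expo r s) (1 : K) * hermitianPoly q K +
        (monomial (expo r (s + q)) 1 - monomial a 1) +
        (monomial (expo r (s + 1)) 1 - monomial a' 1) + monomial a' 1 := by
      rw [hbe]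
      simp only [monomial_expo, hermitianPoly]
      ring
    rw [key]
    exact add_mem (add_mem (add_mem h5 hma) h4) h3

theorem below_le_sup_low {q : ℕ} (hq : 2 ≤ q) {J : Ideal (MvPolynomial (Fin 2) K)}
    (hJ : hermitianPoly q K ∈ J) (k : ℕ) :
    below q K k ≤ J.restrictScalars K ⊔ low q K k := by
  refine restrictSupport_le fun b hb => ?_
  obtain ⟨a, ha, hw, hm⟩ := exists_reduced hq hJ b
  have h1 := sup_le_sup_left (low_mono (K := K) q (le_of_lt hb)) (J.restrictScalars K) hm
  have h2 : monomial a (1 : K) ∈ J.restrictScalars K ⊔ low q K k :=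
    Submodule.mem_sup_right (monomial_mem_low ha (hw.trans_lt hb) 1)
  simpa using add_mem h1 h2

/-- If modulo an ideal and polynomials of smaller weighted degree every monomial is a combination of
the monomials in `S`, then the monomials in `S` span the quotient by the ideal. -/
theorem sup_restrictSupport_eq_top {q : ℕ} {J : Ideal (MvPolynomial (Fin 2) K)}
    {S : Set (Fin 2 →₀ ℕ)}
    (h : ∀ a, monomial a 1 ∈
      J.restrictScalars K ⊔ restrictSupport K S ⊔ below q K (wt q a)) :
    J.restrictScalars K ⊔ restrictSupport K S = ⊤ := by
  have key : ∀ n, below q K n ≤ J.restrictScalars K ⊔ restrictSupport K S := by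
    intro n
    induction n with
    | zero => exact restrictSupport_le fun a ha => absurd ha (Nat.not_lt_zero _)
    | succ n ih =>
      refine restrictSupport_le fun a ha => ?_
      have h1 : wt q a ≤ n := Nat.lt_succ_iff.1 ha
      exact sup_le le_rfl ((below_mono q h1).trans ih) (h a)
  rw [eq_top_iff, ← restrictSupport_univ]
  exact restrictSupport_le fun a _ => key _ (monomial_mem_below (Nat.lt_succ_self _) 1)

end Monomials

/-! ### The footprint of a set of curve points. -/

section Footprint

variable {K : Type*} [Field K]

/-- The footprint of a set `D` of points: the exponents of degree at most `q` in `x` that are not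
leading exponents, for the weighted degree, of polynomials vanishing on `D`. -/
def footprint (q : ℕ) (D : Set (Fin 2 → K)) : Set (Fin 2 →₀ ℕ) :=
  {a | a 0 ≤ q ∧ ∀ f ∈ low q K (wt q a), monomial a 1 - f ∉ vanishingIdeal K D}

theorem mem_vanishingIdeal {D : Set (Fin 2 → K)} {f : MvPolynomial (Fin 2) K} :
    f ∈ vanishingIdeal K D ↔ ∀ P ∈ D, eval P f = 0 := by
  simp [mem_vanishingIdeal_iff, aeval_eq_eval]

/-- `D` consists of points of the Hermitian curve. -/
def OnCurve (q : ℕ) (D : Set (Fin 2 → K)) : Prop :=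
  hermitianPoly q K ∈ vanishingIdeal K D

theorem footprint_mono (q : ℕ) {D D' : Set (Fin 2 → K)} (h : D ⊆ D') :
    footprint q D ⊆ footprint q D' :=
  fun _ ha => ⟨ha.1, fun f hf hm => ha.2 f hf (vanishingIdeal_anti_mono h hm)⟩

theorem exists_of_notMem_footprint {q : ℕ} {D : Set (Fin 2 → K)} {a : Fin 2 →₀ ℕ} (h0 : a 0 ≤ q)
    (ha : a ∉ footprint q D) :
    ∃ f ∈ low q K (wt q a), monomial a 1 - f ∈ vanishingIdeal K D := by
  simpa [footprint, h0] using ha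

/-- An exponent is not in the footprint if a polynomial with this leading exponent, not necessarily
reduced, vanishes on `D`. -/
theorem notMem_footprint {q : ℕ} (hq : 2 ≤ q) {D : Set (Fin 2 → K)} (hD : OnCurve q D)
    {a b : Fin 2 →₀ ℕ} (hab : wt q a = wt q b) {f : MvPolynomial (Fin 2) K}
    (hf : f ∈ below q K (wt q b)) (hm : monomial b 1 - f ∈ vanishingIdeal K D) :
    a ∉ footprint q D := by
  intro ha
  obtain ⟨a', ha', hw, hr⟩ := exists_reduced hq hD b
  obtain rfl : a = a' := eq_of_wt_eq ha.1 ha' (hab.trans hw.symm)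
  have h1 := below_le_sup_low hq hD (wt q b) hf
  have h2 : monomial a (1 : K) ∈ (vanishingIdeal K D).restrictScalars K ⊔ low q K (wt q b) := by
    have h3 : monomial b 1 - f ∈ (vanishingIdeal K D).restrictScalars K ⊔ low q K (wt q b) :=
      Submodule.mem_sup_left hm
    have := sub_mem (add_mem h3 h1) hr
    simpa using this
  obtain ⟨j, hj, g, hg, hjg⟩ := Submodule.mem_sup.1 h2
  refine ha.2 g (by rwa [hab]) ?_
  rw [← hjg, add_sub_cancel_right]
  exact hj

/-- A vanishing polynomial led by `a`, times the monomial of exponent `b`, is led by a monomial of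
the weight of `c`. This makes the footprint closed under divisors in the semigroup. -/
theorem mem_footprint_of_wt_add {q : ℕ} (hq : 2 ≤ q) {D : Set (Fin 2 → K)} (hD : OnCurve q D)
    {a b c : Fin 2 →₀ ℕ} (hc : c ∈ footprint q D) (ha : a 0 ≤ q) (h : wt q a + wt q b = wt q c) :
    a ∈ footprint q D := by
  by_contra hna
  obtain ⟨f, hf, hm⟩ := exists_of_notMem_footprint ha hna
  refine notMem_footprint hq hD (b := a + b) (f := f * monomial b 1) (by rw [wt_add, h]) ?_ ?_ hc
  · rw [wt_add]
    exact mul_monomial_mem_below (low_le_below _ _ hf) b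
  · rw [monomial_mul_one, ← sub_mul]
    exact Ideal.mul_mem_right _ _ hm

/-- Normalised to be monic, a nonzero such `f` would show that its own leading exponent is outside
the footprint. -/
theorem eq_zero_of_mem_footprint {q : ℕ} {D : Set (Fin 2 → K)} {f : MvPolynomial (Fin 2) K}
    (hf : f ∈ restrictSupport K (footprint q D)) (hv : f ∈ vanishingIdeal K D) : f = 0 := by
  by_contra h0
  obtain ⟨a, ha, hmax⟩ := f.support.exists_max_image (wt q) (support_nonempty.2 h0)
  have hc : coeff a f ≠ 0 := mem_support_iff.1 ha
  have haf : a ∈ footprint q D := hf ha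
  have hg : f - monomial a (coeff a f) ∈ low q K (wt q a) := by
    rw [low, mem_restrictSupport_iff]
    intro b hb
    have hb' := mem_support_iff.1 hb
    rw [coeff_sub, coeff_monomial] at hb'
    have hba : a ≠ b := by
      rintro rfl
      simp at hb'
    rw [if_neg hba, sub_zero] at hb'
    have hbs : b ∈ f.support := mem_support_iff.2 hb'
    refine ⟨(hf hbs).1, lt_of_le_of_ne (hmax b hbs) fun hw => hba ?_⟩
    exact (eq_of_wt_eq (hf hbs).1 haf.1 hw).symm
  refine haf.2 (-((coeff a f)⁻¹ • (f - monomial a (coeff a f))))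
    (neg_mem (Submodule.smul_mem _ _ hg)) ?_
  have : monomial a (1 : K) - -((coeff a f)⁻¹ • (f - monomial a (coeff a f))) =
      C (coeff a f)⁻¹ * f := by
    rw [smul_sub, smul_monomial, smul_eq_mul, inv_mul_cancel₀ hc, smul_eq_C_mul]
    ring
  rw [this]
  exact Ideal.mul_mem_left _ _ hv

theorem vanishingIdeal_sup_footprint {q : ℕ} (hq : 2 ≤ q) {D : Set (Fin 2 → K)}
    (hD : OnCurve q D) :
    (vanishingIdeal K D).restrictScalars K ⊔ restrictSupport K (footprint q D) = ⊤ := by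
  refine sup_restrictSupport_eq_top (q := q) fun b => ?_
  obtain ⟨a, ha, hw, hm⟩ := exists_reduced hq hD b
  have h1 : monomial b (1 : K) - monomial a 1 ∈ (vanishingIdeal K D).restrictScalars K ⊔
      restrictSupport K (footprint q D) ⊔ below q K (wt q b) :=
    (show (vanishingIdeal K D).restrictScalars K ⊔ low q K (wt q b) ≤ _ from
      sup_le_sup le_sup_left (low_le_below _ _)) hm
  suffices h2 : monomial a (1 : K) ∈ (vanishingIdeal K D).restrictScalars K ⊔
      restrictSupport K (footprint q D) ⊔ below q K (wt q b) by
    simpa using add_mem h1 h2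
  by_cases haf : a ∈ footprint q D
  · exact Submodule.mem_sup_left (Submodule.mem_sup_right
      ((monomial_mem_restrictSupport K).2 (Or.inl haf)))
  · obtain ⟨f, hf, hv⟩ := exists_of_notMem_footprint ha haf
    rw [hw] at hf
    have h3 : monomial a 1 - f ∈ (vanishingIdeal K D).restrictScalars K ⊔
        restrictSupport K (footprint q D) ⊔ below q K (wt q b) :=
      Submodule.mem_sup_left (Submodule.mem_sup_left hv)
    simpa using add_mem h3 (Submodule.mem_sup_right (low_le_below _ _ hf))

/-- An ideal of polynomials vanishing on `D` is the whole vanishing ideal as soon as, modulo it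
and polynomials of smaller weighted degree, every monomial is a combination of the footprint. -/
theorem vanishingIdeal_eq {q : ℕ} {D : Set (Fin 2 → K)} {J : Ideal (MvPolynomial (Fin 2) K)}
    (hJ : J ≤ vanishingIdeal K D)
    (h : ∀ a, monomial a 1 ∈ J.restrictScalars K ⊔ restrictSupport K (footprint q D) ⊔
      below q K (wt q a)) : vanishingIdeal K D = J := by
  refine le_antisymm (fun f hf => ?_) hJ
  have : f ∈ J.restrictScalars K ⊔ restrictSupport K (footprint q D) := by
    rw [sup_restrictSupport_eq_top h]; trivial
  obtain ⟨j, hj, g, hg, rfl⟩ := Submodule.mem_sup.1 this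
  have hg0 : g = 0 := eq_zero_of_mem_footprint hg (by
    simpa using sub_mem hf (hJ hj))
  simpa [hg0] using hj

/-- The values of a polynomial on `D`. -/
noncomputable def evalOn (D : Set (Fin 2 → K)) : MvPolynomial (Fin 2) K →ₗ[K] (D → K) where
  toFun f := fun P => eval P.1 f
  map_add' f g := by ext P; simp
  map_smul' a f := by ext P; simp

theorem evalOn_eq_zero {D : Set (Fin 2 → K)} {f : MvPolynomial (Fin 2) K} :
    evalOn D f = 0 ↔ f ∈ vanishingIdeal K D := by
  rw [mem_vanishingIdeal, funext_iff]
  exact ⟨fun h P hP => h ⟨P, hP⟩, fun h P => h P.1 P.2⟩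

theorem evalOn_surjective [Finite K] (D : Set (Fin 2 → K)) : Function.Surjective (evalOn D) := by
  intro g
  have := Fintype.ofFinite K
  have h : Function.extend Subtype.val g 0 ∈
      (restrictDegree (Fin 2) K (Fintype.card K - 1)).map (evalₗ K (Fin 2)) := by
    rw [map_restrict_dom_evalₗ]; trivial
  obtain ⟨f, -, hf⟩ := h
  refine ⟨f, funext fun P => ?_⟩
  have := congrFun hf P.1
  rw [Subtype.val_injective.extend_apply] at this
  exact this

theorem exists_footprint_evalOn_eq [Finite K] {q : ℕ} (hq : 2 ≤ q) {D : Set (Fin 2 → K)}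
    (hD : OnCurve q D) (g : D → K) :
    ∃ f ∈ restrictSupport K (footprint q D), evalOn D f = g := by
  obtain ⟨f, rfl⟩ := evalOn_surjective D g
  have : f ∈ (vanishingIdeal K D).restrictScalars K ⊔ restrictSupport K (footprint q D) := by
    rw [vanishingIdeal_sup_footprint hq hD]; trivial
  obtain ⟨j, hj, g, hg, rfl⟩ := Submodule.mem_sup.1 this
  exact ⟨g, hg, by rw [map_add, evalOn_eq_zero.2 hj, zero_add]⟩

/-- The values on `D` of the polynomials supported on the footprint. -/
noncomputable def footprintEquiv [Finite K] {q : ℕ} (hq : 2 ≤ q) {D : Set (Fin 2 → K)}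
    (hD : OnCurve q D) : restrictSupport K (footprint q D) ≃ₗ[K] (D → K) :=
  LinearEquiv.ofBijective ((evalOn D).domRestrict _) <| by
    constructor
    · rw [← LinearMap.ker_eq_bot, LinearMap.ker_eq_bot']
      intro f hf
      exact Subtype.ext (eq_zero_of_mem_footprint f.2 (evalOn_eq_zero.1 hf))
    · intro g
      obtain ⟨f, hf, rfl⟩ := exists_footprint_evalOn_eq hq hD g
      exact ⟨⟨f, hf⟩, rfl⟩

theorem finite_footprint [Finite K] {q : ℕ} (hq : 2 ≤ q) {D : Set (Fin 2 → K)}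
    (hD : OnCurve q D) : (footprint q D).Finite := by
  have : Module.Finite K (restrictSupport K (footprint q D)) :=
    Module.Finite.equiv (footprintEquiv hq hD).symm
  exact Set.finite_coe_iff.1 (Module.Finite.finite_basis (basisRestrictSupport K (footprint q D)))

theorem ncard_footprint [Finite K] {q : ℕ} (hq : 2 ≤ q) {D : Set (Fin 2 → K)}
    (hD : OnCurve q D) : (footprint q D).ncard = D.ncard := by
  have := Fintype.ofFinite D
  have h := (footprintEquiv hq hD).finrank_eq
  rw [Module.finrank_eq_nat_card_basis (basisRestrictSupport K (footprint q D)),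
    Module.finrank_fintype_fun_eq_card, ← Nat.card_eq_fintype_card] at h
  exact h

end Footprint

/-! ### The numerical semigroup generated by `q` and `q + 1`. -/

section Semigroup

variable {q : ℕ}

theorem natCast_mem_Lam (r s : ℕ) : (r * q + s * (q + 1) : ℤ) ∈ Lam q := by
  have h1 : (q : ℤ) ∈ Lam q := AddSubmonoid.subset_closure (by simp)
  have h2 : (q : ℤ) + 1 ∈ Lam q := AddSubmonoid.subset_closure (by simp)
  have := add_mem (nsmul_mem h1 r) (nsmul_mem h2 s)
  simpa using this

theorem exists_of_mem_Lam {z : ℤ} (hz : z ∈ Lam q) : ∃ r s : ℕ, z = r * q + s * (q + 1) := by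
  rw [Lam, AddSubmonoid.mem_closure_pair] at hz
  obtain ⟨r, s, h⟩ := hz
  exact ⟨r, s, by rw [← h]; simp⟩

theorem exists_le_of_mem_Lam {z : ℤ} (hz : z ∈ Lam q) :
    ∃ r s : ℕ, r ≤ q ∧ z = r * q + s * (q + 1) := by
  obtain ⟨r, s, rfl⟩ := exists_of_mem_Lam hz
  refine ⟨r % (q + 1), s + r / (q + 1) * q, Nat.lt_succ_iff.1 (Nat.mod_lt _ q.succ_pos), ?_⟩
  have h : (r : ℤ) = (q + 1) * (r / (q + 1) : ℕ) + (r % (q + 1) : ℕ) := by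
    exact_mod_cast (Nat.div_add_mod r (q + 1)).symm
  push_cast at h ⊢
  linear_combination (q : ℤ) * h

/-- The elements using `c` generators fill the interval from `c * q` to `c * q + c`; here `c * q + d
= (c - d) * q + d * (q + 1)`. -/
theorem mem_Lam_iff {c d : ℤ} (hd : 0 ≤ d) (hdq : d < q) : c * q + d ∈ Lam q ↔ d ≤ c := by
  constructor
  · intro h
    obtain ⟨r, s, h⟩ := exists_of_mem_Lam h
    by_contra! hlt
    have h1 : (q : ℤ) * (r + s - c) = d - s := by linear_combination -h
    have h2 : (r : ℤ) + s - c ≤ 0 := by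
      by_contra! h3
      have : (q : ℤ) ≤ q * (r + s - c) := le_mul_of_one_le_right (by omega) (by omega)
      omega
    have : (q : ℤ) * (r + s - c) ≤ 0 := mul_nonpos_of_nonneg_of_nonpos (by omega) h2
    omega
  · intro h
    have := natCast_mem_Lam (q := q) (c - d).toNat d.toNat
    rw [Int.toNat_of_nonneg (by omega), Int.toNat_of_nonneg hd] at this
    convert this using 1
    ring

/-- The semigroup is symmetric. -/
theorem mem_Lam_symm (hq : 1 ≤ q) (z : ℤ) : (q : ℤ) ^ 2 - q - 1 - z ∈ Lam q ↔ z ∉ Lam q := by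
  have hq' : (0 : ℤ) < q := by omega
  have h0 := Int.emod_nonneg z hq'.ne'
  have h1 := Int.emod_lt_of_pos z hq'
  have hz : z = z / q * q + z % q := by rw [mul_comm]; exact (Int.mul_ediv_add_emod z q).symm
  generalize z / q = c at hz
  generalize z % q = d at *
  subst hz
  -- The reflection turns quotient and remainder `(c, d)` into `(q - 2 - c, q - 1 - d)`, and `q - 1
  -- - d ≤ q - 2 - c` is the negation of `d ≤ c`.
  have h2 : (q : ℤ) ^ 2 - q - 1 - (c * q + d) = (q - 2 - c) * q + (q - 1 - d) := by ring
  rw [h2, mem_Lam_iff h0 h1, mem_Lam_iff (by omega) (by omega)]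
  omega

theorem wt_mem_Lam (a : Fin 2 →₀ ℕ) : (wt q a : ℤ) ∈ Lam q := by
  have := natCast_mem_Lam (q := q) (a 0) (a 1)
  rw [wt_eq]
  exact_mod_cast this

end Semigroup

/-! ### Counting divisors: the lower bound for the number of points. -/

section Divisors

/-- Exponents of the form `(r, s)`, `r ≤ q`, whose complement in `wt q (expo r s)` belongs to the
semigroup. -/
def boxes (q r s : ℕ) : Finset (ℕ × ℕ) :=
  Finset.range (r + 1) ×ˢ Finset.range (s + 1) ∪ Finset.Ioc r q ×ˢ Finset.range (s + 1 - q)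

theorem card_boxes (q r s : ℕ) :
    (boxes q r s).card = (r + 1) * (s + 1) + (q - r) * (s + 1 - q) := by
  rw [boxes, Finset.card_union_of_disjoint]
  · simp
  · rw [Finset.disjoint_left]
    rintro ⟨i, j⟩ h1 h2
    simp only [Finset.mem_product, Finset.mem_range, Finset.mem_Ioc] at h1 h2
    omega

theorem exists_wt_add_of_mem_boxes {q r s : ℕ} {p : ℕ × ℕ} (hp : p ∈ boxes q r s) (hr : r ≤ q) :
    p.1 ≤ q ∧ ∃ c, wt q (expo p.1 p.2) + wt q c = wt q (expo r s) := by
  obtain ⟨i, j⟩ := p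
  simp only [boxes, Finset.mem_union, Finset.mem_product, Finset.mem_range, Finset.mem_Ioc] at hp
  rcases hp with ⟨h1, h2⟩ | ⟨⟨h1, h2⟩, h3⟩
  · refine ⟨by simp; omega, expo (r - i) (s - j), ?_⟩
    rw [← wt_add, expo_add]
    congr 2 <;> simp <;> omega
  -- Since `x ^ (q + 1)` and `y ^ q` have equal weight, `q` factors `y` can be traded for `q + 1`
  -- factors `x`.
  · refine ⟨h2, expo (r + (q + 1) - i) (s - j - q), ?_⟩
    rw [← wt_add, expo_add]
    have h4 : i + (r + (q + 1) - i) = r + (q + 1) := by omega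
    obtain ⟨t, rfl⟩ : ∃ t, s = t + j + q := ⟨s - j - q, by omega⟩
    have h5 : j + (t + j + q - j - q) = j + t := by omega
    simp only [h4, h5, wt_expo]
    ring

theorem expo_injective : Function.Injective fun p : ℕ × ℕ => expo p.1 p.2 := by
  intro p p' h
  have h0 := DFunLike.congr_fun h 0
  have h1 := DFunLike.congr_fun h 1
  simp only [expo_zero, expo_one] at h0 h1
  exact Prod.ext h0 h1

/-- The Goppa bound is at most the number of divisors. -/
theorem le_card_boxes {q r s : ℕ} (hr : r ≤ q) :
    wt q (expo r s) + q + 1 ≤ (r + 1) * (s + 1) + (q - r) * (s + 1 - q) + q ^ 2 := by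
  rw [wt_expo]
  obtain ⟨t, rfl⟩ := Nat.exists_eq_add_of_le hr
  rw [Nat.add_sub_cancel_left]
  -- Here `q = r + t`. The slack in the inequality is `(q - r) * (q - s - 1)` when `s + 1 ≤ q`, and
  -- zero otherwise.
  rcases le_total (s + 1) (r + t) with h | h
  · obtain ⟨u, hu⟩ := Nat.exists_eq_add_of_le h
    rw [hu, Nat.sub_eq_zero_of_le (by omega)]
    have : (r : ℤ) + t = s + 1 + u := by exact_mod_cast hu
    zify
    rw [show (s : ℤ) + 1 + u = r + t from this.symm]
    have h3 : (s : ℤ) = r + t - 1 - u := by linarith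
    rw [h3]
    nlinarith [mul_nonneg (Int.natCast_nonneg t) (Int.natCast_nonneg u)]
  · obtain ⟨u, hu⟩ := Nat.exists_eq_add_of_le h
    rw [hu, Nat.add_sub_cancel_left]
    have h3 : (s : ℤ) = r + t + u - 1 := by
      have : (s : ℤ) + 1 = r + t + u := by exact_mod_cast hu
      linarith
    zify
    rw [h3]
    nlinarith

variable {K : Type*} [Field K] {q : ℕ} {D : Set (Fin 2 → K)} {a : Fin 2 →₀ ℕ}

theorem boxes_subset_footprint (hq : 2 ≤ q) (hD : OnCurve q D) (ha : a ∈ footprint q D) :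
    (fun p : ℕ × ℕ => expo p.1 p.2) '' (boxes q (a 0) (a 1)) ⊆ footprint q D := by
  rintro _ ⟨p, hp, rfl⟩
  obtain ⟨h1, c, hc⟩ := exists_wt_add_of_mem_boxes hp ha.1
  rw [expo_eta] at hc
  exact mem_footprint_of_wt_add hq hD ha (by simpa using h1) hc

theorem ncard_image_boxes (r s : ℕ) :
    ((fun p : ℕ × ℕ => expo p.1 p.2) '' (boxes q r s : Set (ℕ × ℕ))).ncard =
      (r + 1) * (s + 1) + (q - r) * (s + 1 - q) := by
  rw [Set.ncard_image_of_injective _ expo_injective, Set.ncard_coe_finset, card_boxes]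

variable [Finite K]

theorem card_boxes_le_ncard (hq : 2 ≤ q) (hD : OnCurve q D) (ha : a ∈ footprint q D) :
    (a 0 + 1) * (a 1 + 1) + (q - a 0) * (a 1 + 1 - q) ≤ D.ncard := by
  rw [← ncard_footprint hq hD, ← ncard_image_boxes]
  exact Set.ncard_le_ncard (boxes_subset_footprint hq hD ha) (finite_footprint hq hD)

theorem wt_le_ncard (hq : 2 ≤ q) (hD : OnCurve q D) (ha : a ∈ footprint q D) :
    wt q a + q + 1 ≤ D.ncard + q ^ 2 := by
  have h1 := card_boxes_le_ncard hq hD ha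
  have h2 := le_card_boxes (s := a 1) ha.1
  rw [expo_eta] at h2
  omega

/-- The equality case: a footprint no larger than the set of divisors of one of its elements is that
set. -/
theorem footprint_eq_boxes (hq : 2 ≤ q) (hD : OnCurve q D) (ha : a ∈ footprint q D)
    (h : D.ncard ≤ (a 0 + 1) * (a 1 + 1) + (q - a 0) * (a 1 + 1 - q)) :
    footprint q D = (fun p : ℕ × ℕ => expo p.1 p.2) '' (boxes q (a 0) (a 1)) := by
  refine (Set.eq_of_subset_of_ncard_le (boxes_subset_footprint hq hD ha) ?_
    (finite_footprint hq hD)).symm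
  rwa [ncard_image_boxes, ncard_footprint hq hD]

theorem mem_footprint_iff_sub_mem_Lam (hq : 2 ≤ q) (hD : OnCurve q D) (ha : a ∈ footprint q D)
    (h : D.ncard ≤ (a 0 + 1) * (a 1 + 1) + (q - a 0) * (a 1 + 1 - q)) {b : Fin 2 →₀ ℕ}
    (hb : b 0 ≤ q) : b ∈ footprint q D ↔ (wt q a : ℤ) - wt q b ∈ Lam q := by
  constructor
  · intro hbf
    rw [footprint_eq_boxes hq hD ha h] at hbf
    obtain ⟨p, hp, rfl⟩ := hbf
    obtain ⟨h1, c, hc⟩ := exists_wt_add_of_mem_boxes hp ha.1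
    rw [expo_eta] at hc
    have := wt_mem_Lam (q := q) c
    rwa [← hc, Nat.cast_add, add_sub_cancel_left]
  · intro hl
    obtain ⟨r, s, hrs⟩ := exists_of_mem_Lam hl
    refine mem_footprint_of_wt_add hq hD ha hb (b := expo r s) ?_
    rw [wt_expo]
    zify
    linarith

end Divisors

/-! ### From the shape of the footprint to generators of the ideal. -/

section CompleteIntersections

variable {K : Type*} [Field K] {q : ℕ} {D : Set (Fin 2 → K)} {a : Fin 2 →₀ ℕ}

/-- The weight is `(q + 1)` times the degree minus the `x`-exponent. For monomials of `f` that
exponent is at most `q`, so smaller weight means smaller degree, or equal degree and more factors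
`x`: the degree reverse lexicographic order. -/
theorem hasLeadingMonomial_monomial_sub {r s : ℕ} {f : MvPolynomial (Fin 2) K}
    (hf : f ∈ low q K (wt q (expo r s))) :
    HasLeadingMonomial (monomial (expo r s) 1 - f) r s := by
  have hself : expo r s ∉ f.support := fun h => lt_irrefl _ (hf h).2
  refine ⟨expo r s, ?_, by simp, by simp, fun b hb hne => ?_⟩
  · rw [mem_support_iff, coeff_sub, coeff_monomial, if_pos rfl, notMem_support_iff.1 hself]
    simp
  · rw [mem_support_iff, coeff_sub, coeff_monomial, if_neg (Ne.symm hne), zero_sub, neg_ne_zero,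
      ← mem_support_iff] at hb
    obtain ⟨h0, h1⟩ := hf hb
    rw [wt_eq, wt_expo] at h1
    have h2 : (b 0 + b 1) * (q + 1) + r < (r + s) * (q + 1) + b 0 := by nlinarith
    simp only [MonLT, expo_zero, expo_one]
    rcases lt_trichotomy (b 0 + b 1) (r + s) with h | h | h
    · exact Or.inl h
    · refine Or.inr ⟨h, ?_⟩
      rw [h] at h2
      omega
    · have : (r + s + 1) * (q + 1) ≤ (b 0 + b 1) * (q + 1) := Nat.mul_le_mul_right _ h
      nlinarith

theorem totalDegree_ne_zero_of_mem_support {f : MvPolynomial (Fin 2) K} (ha : a ∈ f.support)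
    (h : a 0 + a 1 ≠ 0) : f.totalDegree ≠ 0 := by
  have := le_totalDegree ha
  rw [Finsupp.sum_fintype _ _ (by simp), Fin.sum_univ_two] at this
  omega

theorem HasLeadingMonomial.totalDegree_ne_zero {F : MvPolynomial (Fin 2) K} {r s : ℕ}
    (h : HasLeadingMonomial F r s) (hrs : r + s ≠ 0) : F.totalDegree ≠ 0 := by
  obtain ⟨b, hb, rfl, rfl, -⟩ := h
  exact totalDegree_ne_zero_of_mem_support hb hrs

theorem totalDegree_hermitianPoly_ne_zero :
    (hermitianPoly q K).totalDegree ≠ 0 := by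
  refine totalDegree_ne_zero_of_mem_support (a := expo (q + 1) 0) ?_ (by simp)
  have h : hermitianPoly q K = monomial (expo (q + 1) 0) 1 - monomial (expo 0 q) 1 -
      monomial (expo 0 1) 1 := by
    simp only [monomial_expo, hermitianPoly]; ring
  have h1 : expo 0 q ≠ expo (q + 1) 0 := fun h => by simpa using DFunLike.congr_fun h 0
  have h2 : expo 0 1 ≠ expo (q + 1) 0 := fun h => by simpa using DFunLike.congr_fun h 0
  rw [mem_support_iff, h, coeff_sub, coeff_sub, coeff_monomial, coeff_monomial, coeff_monomial,
    if_pos rfl, if_neg h1, if_neg h2]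
  simp

theorem totalDegree_ne_zero_of_eval {f : MvPolynomial (Fin 2) K} {P Q : Fin 2 → K}
    (h : eval P f ≠ eval Q f) : f.totalDegree ≠ 0 := by
  intro h0
  rw [totalDegree_eq_zero_iff_eq_C] at h0
  rw [h0] at h
  simp at h

/-- The vanishing ideal is generated by two polynomials `x ^ r - f` and `y ^ s - g` if the monomials
outside the footprint are divisible by `x ^ r` or by `y ^ s`. -/
theorem vanishingIdeal_eq_of_monomials {r s : ℕ} {f g : MvPolynomial (Fin 2) K}
    (hf : f ∈ below q K (wt q (expo r 0))) (hg : g ∈ below q K (wt q (expo 0 s)))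
    (hfD : monomial (expo r 0) 1 - f ∈ vanishingIdeal K D)
    (hgD : monomial (expo 0 s) 1 - g ∈ vanishingIdeal K D)
    (h : ∀ i j, i < r → j < s → expo i j ∈ footprint q D) :
    vanishingIdeal K D =
      Ideal.span {monomial (expo r 0) 1 - f, monomial (expo 0 s) 1 - g} := by
  set J : Ideal (MvPolynomial (Fin 2) K) :=
    Ideal.span {monomial (expo r 0) 1 - f, monomial (expo 0 s) 1 - g} with hJ
  have hJ1 : monomial (expo r 0) 1 - f ∈ J := Ideal.subset_span (by simp)
  have hJ2 : monomial (expo 0 s) 1 - g ∈ J := Ideal.subset_span (by simp)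
  -- A multiple of a leading monomial of `J` drops in weight modulo `J`. No reduction by `H` is
  -- needed, so arbitrary exponents are covered.
  have key : ∀ (b c : Fin 2 →₀ ℕ) (F : MvPolynomial (Fin 2) K), F ∈ below q K (wt q b) →
      monomial b 1 - F ∈ J → monomial (b + c) 1 ∈ J.restrictScalars K ⊔
        restrictSupport K (footprint q D) ⊔ below q K (wt q (b + c)) := by
    intro b c F hF hFJ
    have h1 := mul_monomial_mem_below hF c
    rw [← wt_add] at h1
    have h2 : (monomial b 1 - F) * monomial c 1 ∈ J := J.mul_mem_right _ hFJ
    have h3 : (monomial b 1 - F) * monomial c 1 ∈ J.restrictScalars K ⊔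
        restrictSupport K (footprint q D) ⊔ below q K (wt q (b + c)) :=
      Submodule.mem_sup_left (Submodule.mem_sup_left h2)
    have h4 := add_mem h3 (Submodule.mem_sup_right h1)
    rwa [← add_mul, sub_add_cancel, ← monomial_mul_one] at h4
  refine vanishingIdeal_eq (q := q) (by rw [hJ, Ideal.span_le]; rintro _ (rfl | rfl) <;> assumption)
    fun b => ?_
  by_cases hr : r ≤ b 0
  · have hb : b = expo r 0 + expo (b 0 - r) (b 1) := by
      rw [expo_add, Nat.add_sub_cancel' hr, zero_add, expo_eta]
    rw [hb]
    exact key _ _ f hf hJ1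
  by_cases hs : s ≤ b 1
  · have hb : b = expo 0 s + expo (b 0) (b 1 - s) := by
      rw [expo_add, Nat.add_sub_cancel' hs, zero_add, expo_eta]
    rw [hb]
    exact key _ _ g hg hJ2
  · have := h (b 0) (b 1) (by omega) (by omega)
    rw [expo_eta] at this
    exact Submodule.mem_sup_left (Submodule.mem_sup_right
      ((monomial_mem_restrictSupport K).2 (Or.inl this)))

theorem exists_vanishingIdeal_eq_span_pair {r s : ℕ} (hr : r ≤ q)
    (hrD : expo r 0 ∉ footprint q D) (hsD : expo 0 s ∉ footprint q D)
    (h : ∀ i j, i < r → j < s → expo i j ∈ footprint q D) :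
    ∃ F₁ F₂ : MvPolynomial (Fin 2) K, HasLeadingMonomial F₁ r 0 ∧ HasLeadingMonomial F₂ 0 s ∧
      vanishingIdeal K D = Ideal.span {F₁, F₂} := by
  obtain ⟨f, hf, hfD⟩ := exists_of_notMem_footprint (by simpa using hr) hrD
  obtain ⟨g, hg, hgD⟩ := exists_of_notMem_footprint (by simp) hsD
  exact ⟨_, _, hasLeadingMonomial_monomial_sub hf, hasLeadingMonomial_monomial_sub hg,
    vanishingIdeal_eq_of_monomials (low_le_below _ _ hf) (low_le_below _ _ hg) hfD hgD h⟩

theorem prod_X_sub_C_sub_mem_below (i : Fin 2) (hq : 1 ≤ q) (T : Finset K) :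
    (X i : MvPolynomial (Fin 2) K) ^ T.card - ∏ b ∈ T, (X i - C b) ∈
      below q K (T.card * wt q (Finsupp.single i 1)) := by
  classical
  induction T using Finset.induction_on with
  | empty => simp
  | insert b T hb ih =>
    rw [Finset.prod_insert hb, Finset.card_insert_of_notMem hb]
    set w := wt q (Finsupp.single i 1) with hw
    have hw0 : 0 < w := by
      rw [hw, wt_eq]
      fin_cases i
      · simpa using (by omega : 0 < q)
      · simp
    set p := ∏ b ∈ T, (X i - C b : MvPolynomial (Fin 2) K)
    have h1 := mul_monomial_mem_below ih (Finsupp.single i 1)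
    rw [← hw, ← Nat.succ_mul] at h1
    have h2 : (X i : MvPolynomial (Fin 2) K) ^ T.card ∈ below q K ((T.card + 1) * w) := by
      rw [X_pow_eq_monomial]
      refine monomial_mem_below ?_ 1
      have : wt q (Finsupp.single i T.card) = T.card * w := by
        rw [hw, wt_eq, wt_eq]
        fin_cases i <;> simp
      rw [this, Nat.succ_mul]
      omega
    have h3 : p ∈ below q K ((T.card + 1) * w) := by
      have := sub_mem h2 (below_mono q (Nat.mul_le_mul_right w (Nat.le_succ _)) ih)
      simpa using this
    have h4 := add_mem h1 (Submodule.smul_mem _ b h3)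
    convert h4 using 1
    rw [smul_eq_C_mul, X]
    ring

theorem X_zero_sub_C_mem_vanishingIdeal_iff {u : K} :
    x K - C u ∈ vanishingIdeal K D ↔ ∀ P ∈ D, P 0 = u := by
  simp [x, sub_eq_zero]

theorem totalDegree_prod_ne_zero {i : Fin 2} {T : Finset K} {t : K} (ht : t ∉ T)
    (hT : T.Nonempty) : (∏ b ∈ T, (X i - C b : MvPolynomial (Fin 2) K)).totalDegree ≠ 0 := by
  obtain ⟨b, hb⟩ := hT
  refine totalDegree_ne_zero_of_eval (P := fun _ => t) (Q := fun _ => b) ?_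
  rw [map_prod, map_prod, Finset.prod_eq_zero (f := fun c => eval (fun _ => b) (X i - C c)) hb
    (by simp)]
  refine Finset.prod_ne_zero_iff.2 fun c hc => ?_
  simpa [sub_eq_zero] using fun h : t = c => ht (h ▸ hc)

variable [Fintype K]

/-- As `x` is not in the footprint, it agrees on `D` with a polynomial of weight below `q`, that is,
a constant. The points are then separated by `y`; `hcard` serves only to make the product of linear
factors nonconstant. -/
theorem exists_isIntersection_vertical (hq : 2 ≤ q) {h : ℕ} (hcard : h + 1 < Fintype.card K)
    (hD : OnCurve q D)
    (hfp : footprint q D = (fun j => expo 0 j) '' Set.Iic h) :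
    ∃ (u : K) (T : Finset K), T.card = h + 1 ∧
      IsIntersection D (x K - C u) (∏ b ∈ T, (y K - C b)) := by
  classical
  have hn : expo 1 0 ∉ footprint q D := by
    rw [hfp]
    rintro ⟨j, -, hj⟩
    simpa using DFunLike.congr_fun hj 0
  obtain ⟨f, hf, hfD⟩ := exists_of_notMem_footprint (by simp; omega) hn
  obtain ⟨u, rfl⟩ : ∃ u, f = C u := by
    refine ⟨coeff 0 f, ?_⟩
    ext b
    rw [coeff_C]
    split_ifs with h0
    · rw [h0]
    · by_contra hb
      obtain ⟨h1, h2⟩ := hf (mem_support_iff.2 hb)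
      rw [wt_eq, wt_expo] at h2
      refine h0 (exponent_ext ?_ ?_).symm
      · by_contra h3
        have : 1 * q ≤ b 0 * q := Nat.mul_le_mul_right _ (Nat.one_le_iff_ne_zero.2 h3)
        omega
      · by_contra h3
        have : 1 * (q + 1) ≤ b 1 * (q + 1) :=
          Nat.mul_le_mul_right _ (Nat.one_le_iff_ne_zero.2 h3)
        omega
  have hx : monomial (expo 1 0) (1 : K) = x K := by simp [monomial_expo]
  rw [hx] at hfD
  have hu := X_zero_sub_C_mem_vanishingIdeal_iff.1 hfD
  have hinj : Set.InjOn (fun P : Fin 2 → K => P 1) D := by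
    intro P hP Q hQ hPQ
    funext i
    fin_cases i
    · exact (hu P hP).trans (hu Q hQ).symm
    · exact hPQ
  have hcardD : D.ncard = h + 1 := by
    rw [← ncard_footprint hq hD, hfp, Set.ncard_image_of_injective]
    · rw [← Finset.coe_Iic, Set.ncard_coe_finset, Nat.card_Iic]
    · intro i j hij
      simpa using DFunLike.congr_fun hij 1
  set T : Finset K := ((fun P : Fin 2 → K => P 1) '' D).toFinset with hT
  have hTc : T.card = h + 1 := by
    rw [hT, ← Set.ncard_eq_toFinset_card', hinj.ncard_image, hcardD]
  have hy : X (1 : Fin 2) ^ (h + 1) = monomial (expo 0 (h + 1)) (1 : K) := by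
    simp [monomial_expo]
  have hprod : ∏ b ∈ T, (y K - C b) ∈ vanishingIdeal K D := by
    rw [mem_vanishingIdeal]
    intro P hP
    rw [map_prod]
    exact Finset.prod_eq_zero (i := P 1) (by rw [hT, Set.mem_toFinset]; exact ⟨P, hP, rfl⟩)
      (by simp)
  have hg := prod_X_sub_C_sub_mem_below (q := q) 1 (by omega) T
  have hw : T.card * wt q (Finsupp.single 1 1) = wt q (expo 0 (h + 1)) := by
    rw [wt_eq, wt_expo, hTc]; simp
  rw [hw, hTc, hy] at hg
  refine ⟨u, T, hTc, ?_, ?_, ?_⟩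
  · refine totalDegree_ne_zero_of_eval (P := fun _ => 0) (Q := fun _ => 1) ?_
    simp [x, sub_eq_add_neg]
  · obtain ⟨t, -, ht⟩ := Finset.exists_mem_notMem_of_card_lt_card
      (s := T) (t := Finset.univ) (by rw [Finset.card_univ]; omega)
    exact totalDegree_prod_ne_zero ht (Finset.card_pos.1 (by omega))
  · have := vanishingIdeal_eq_of_monomials (low_le_below _ _ hf) hg (by rwa [hx])
      (by simpa [y] using hprod) (fun i j hi hj => by
        obtain rfl : i = 0 := by omega
        rw [hfp]
        exact ⟨j, Nat.lt_succ_iff.1 hj, rfl⟩)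
    simpa [hx, y] using this

/-- As `y` is not in the footprint, it agrees on `D` with a polynomial of weight below `q + 1`, that
is, a combination of `1` and `x`. -/
theorem exists_isIntersection_line (hq : 2 ≤ q) {h : ℕ} (hcard : h + 1 < Fintype.card K)
    (hh : 1 ≤ h) (hD : OnCurve q D)
    (hfp : footprint q D = (fun j => expo j 0) '' Set.Iic h) :
    ∃ (u v : K) (T : Finset K), (u ≠ 0 ∨ v ≠ 0) ∧ T.card = h + 1 ∧
      IsIntersection D (y K - C u * x K - C v) (∏ a ∈ T, (x K - C a)) := by
  classical
  have hn : expo 0 1 ∉ footprint q D := by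
    rw [hfp]
    rintro ⟨j, -, hj⟩
    simpa using DFunLike.congr_fun hj 1
  obtain ⟨f, hf, hfD⟩ := exists_of_notMem_footprint (by simp) hn
  obtain ⟨u, v, rfl⟩ : ∃ u v, f = C u * x K + C v := by
    refine ⟨coeff (expo 1 0) f, coeff 0 f, ?_⟩
    have hx : x K = monomial (expo 1 0) 1 := by simp [monomial_expo]
    ext b
    rw [coeff_add, coeff_C_mul, hx, coeff_monomial, coeff_C]
    have h10 : expo 1 0 ≠ 0 := fun h => by simpa using DFunLike.congr_fun h 0
    by_cases hb1 : expo 1 0 = b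
    · rw [if_pos hb1, if_neg (by rw [← hb1]; exact h10.symm), hb1]; simp
    by_cases hb0 : 0 = b
    · rw [if_neg hb1, if_pos hb0, hb0]; simp
    rw [if_neg hb1, if_neg hb0]
    by_contra hb
    have hb : coeff b f ≠ 0 := by simpa using hb
    obtain ⟨h1, h2⟩ := hf (mem_support_iff.2 hb)
    rw [wt_eq, wt_expo] at h2
    have h3 : b 1 = 0 := by
      by_contra h3
      have : 1 * (q + 1) ≤ b 1 * (q + 1) :=
        Nat.mul_le_mul_right _ (Nat.one_le_iff_ne_zero.2 h3)
      omega
    have h4 : b 0 < 2 := by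
      by_contra! h4
      have : 2 * q ≤ b 0 * q := Nat.mul_le_mul_right _ h4
      omega
    interval_cases h5 : b 0
    · exact hb0 (exponent_ext h5.symm h3.symm)
    · exact hb1 (exponent_ext (by simp [h5]) (by simp [h3]))
  have hy : monomial (expo 0 1) (1 : K) = y K := by simp [monomial_expo]
  rw [hy] at hfD
  have hu : ∀ P ∈ D, P 1 = u * P 0 + v := by
    rw [mem_vanishingIdeal] at hfD
    intro P hP
    simpa [sub_eq_zero, x, y] using hfD P hP
  have hinj : Set.InjOn (fun P : Fin 2 → K => P 0) D := by
    intro P hP Q hQ hPQ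
    have hPQ : P 0 = Q 0 := hPQ
    funext i
    fin_cases i
    · exact hPQ
    · change P 1 = Q 1
      rw [hu P hP, hu Q hQ, hPQ]
  have hcardD : D.ncard = h + 1 := by
    rw [← ncard_footprint hq hD, hfp, Set.ncard_image_of_injective]
    · rw [← Finset.coe_Iic, Set.ncard_coe_finset, Nat.card_Iic]
    · intro i j hij
      simpa using DFunLike.congr_fun hij 0
  set T : Finset K := ((fun P : Fin 2 → K => P 0) '' D).toFinset with hT
  have hTc : T.card = h + 1 := by
    rw [hT, ← Set.ncard_eq_toFinset_card', hinj.ncard_image, hcardD]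
  have hx : X (0 : Fin 2) ^ (h + 1) = monomial (expo (h + 1) 0) (1 : K) := by
    simp [monomial_expo]
  have hprod : ∏ b ∈ T, (x K - C b) ∈ vanishingIdeal K D := by
    rw [mem_vanishingIdeal]
    intro P hP
    rw [map_prod]
    exact Finset.prod_eq_zero (i := P 0) (by rw [hT, Set.mem_toFinset]; exact ⟨P, hP, rfl⟩)
      (by simp)
  have hg := prod_X_sub_C_sub_mem_below (q := q) 0 (by omega) T
  have hw : T.card * wt q (Finsupp.single 0 1) = wt q (expo (h + 1) 0) := by
    rw [wt_eq, wt_expo, hTc]; simp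
  rw [hw, hTc, hx] at hg
  refine ⟨u, v, T, ?_, hTc, ?_, ?_, ?_⟩
  -- The line `y = 0` meets the curve only at the origin, whereas `D` has `h + 1 ≥ 2` points.
  · by_contra! huv
    obtain ⟨rfl, rfl⟩ := huv
    have : D.ncard ≤ 1 := by
      refine (Set.ncard_le_one_iff_subset_singleton).2 ⟨0, fun P hP => ?_⟩
      have h1 : P 1 = 0 := by simpa using hu P hP
      have h2 := mem_vanishingIdeal.1 hD P hP
      simp only [hermitianPoly, x, y, map_sub, map_pow, eval_X, h1] at h2
      have h3 : P 0 = 0 := by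
        rw [zero_pow (by omega), sub_zero, sub_zero] at h2
        exact eq_zero_of_pow_eq_zero h2
      refine funext fun i => ?_
      fin_cases i
      · exact h3
      · exact h1
    omega
  · refine totalDegree_ne_zero_of_eval (P := ![0, 0]) (Q := ![0, 1]) ?_
    simp [x, y, sub_eq_add_neg]
  · obtain ⟨t, -, ht⟩ := Finset.exists_mem_notMem_of_card_lt_card
      (s := T) (t := Finset.univ) (by rw [Finset.card_univ]; omega)
    exact totalDegree_prod_ne_zero ht (Finset.card_pos.1 (by omega))
  · have := vanishingIdeal_eq_of_monomials hg (low_le_below _ _ hf)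
      (by simpa [x] using hprod) (by rwa [hy]) (fun i j hi hj => by
        obtain rfl : j = 0 := by omega
        rw [hfp]
        exact ⟨i, Nat.lt_succ_iff.1 hi, rfl⟩)
    rw [this, Set.pair_comm]
    simp [hy, x, sub_sub]

/-- Sets of points reaching the Goppa bound are cut out on the Hermitian curve by one further
curve. -/
theorem exists_vanishingIdeal_eq_span_hermitianPoly (hq : 2 ≤ q) (hD : OnCurve q D)
    (ha : a ∈ footprint q D) {r s : ℕ} (hr : r ≤ q)
    (hwa : wt q a + q + 1 = wt q (expo r s) + q ^ 2) (hcard : D.ncard ≤ wt q (expo r s)) :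
    ∃ F : MvPolynomial (Fin 2) K, HasLeadingMonomial F r s ∧
      vanishingIdeal K D = Ideal.span {hermitianPoly q K, F} := by
  have hle := le_card_boxes (s := a 1) ha.1
  rw [expo_eta] at hle
  -- The hypotheses make the Goppa bound sharp, so the footprint is the set of divisors of `a`.
  -- Since `wt q a = wt q (expo r s) + q ^ 2 - q - 1`, the symmetry of the semigroup describes the
  -- complement.
  have hmem : ∀ b : Fin 2 →₀ ℕ, b 0 ≤ q →
      (b ∉ footprint q D ↔ (wt q b : ℤ) - wt q (expo r s) ∈ Lam q) := by
    intro b hb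
    rw [mem_footprint_iff_sub_mem_Lam hq hD ha (by omega) hb, ← mem_Lam_symm (by omega)]
    zify at hwa
    have : (q : ℤ) ^ 2 - q - 1 - (wt q a - wt q b) = wt q b - wt q (expo r s) := by
      linarith
    rw [this]
  have hn : expo r s ∉ footprint q D := by
    rw [hmem _ (by simpa using hr), sub_self]
    exact zero_mem _
  obtain ⟨f, hf, hfD⟩ := exists_of_notMem_footprint (by simpa using hr) hn
  refine ⟨_, hasLeadingMonomial_monomial_sub hf, ?_⟩
  set F := monomial (expo r s) 1 - f with hF
  set J : Ideal (MvPolynomial (Fin 2) K) := Ideal.span {hermitianPoly q K, F} with hJ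
  have hJ1 : hermitianPoly q K ∈ J := Ideal.subset_span (by simp)
  have hJ2 : F ∈ J := Ideal.subset_span (by simp)
  refine vanishingIdeal_eq (q := q) (by rw [hJ, Ideal.span_le]; rintro _ (rfl | rfl) <;> assumption)
    fun b => ?_
  set W := J.restrictScalars K ⊔ restrictSupport K (footprint q D) ⊔ below q K (wt q b)
  have hW : J.restrictScalars K ⊔ low q K (wt q b) ≤ W :=
    sup_le_sup le_sup_left (low_le_below _ _)
  obtain ⟨b', hb', hw, hm⟩ := exists_reduced hq hJ1 b
  suffices h2 : monomial b' (1 : K) ∈ W by simpa using add_mem (hW hm) h2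
  by_cases hbf : b' ∈ footprint q D
  · exact Submodule.mem_sup_left (Submodule.mem_sup_right
      ((monomial_mem_restrictSupport K).2 (Or.inl hbf)))
  obtain ⟨i, j, hij⟩ := exists_of_mem_Lam ((hmem b' hb').1 hbf)
  have hwt : wt q (expo r s + expo i j) = wt q b := by
    rw [← hw, wt_add, wt_expo q i j]
    zify
    linarith
  obtain ⟨b'', hb'', hw', hm'⟩ := exists_reduced hq hJ1 (expo r s + expo i j)
  obtain rfl : b' = b'' := eq_of_wt_eq hb' hb'' (by omega)
  rw [hwt] at hm'
  have h3 : F * monomial (expo i j) 1 ∈ W :=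
    Submodule.mem_sup_left (Submodule.mem_sup_left (J.mul_mem_right _ hJ2))
  have h4 := mul_monomial_mem_below (low_le_below _ _ hf) (expo i j)
  rw [← wt_add, hwt] at h4
  have h5 := sub_mem (add_mem h3 (Submodule.mem_sup_right h4)) (hW hm')
  rwa [hF, ← add_mul, sub_add_cancel, ← monomial_mul_one, sub_sub_cancel] at h5

end CompleteIntersections

/-! ### Fibres of the norm and trace maps. -/

section Counting

/-- Turns upper bounds on fibres, obtained by counting roots, into equalities once the total is
known. -/
theorem eq_of_sum_eq_mul {ι : Type*} {s : Finset ι} {f : ι → ℕ} {n m : ℕ} (hm : 0 < m)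
    (hs : s.card ≤ n) (hf : ∀ i ∈ s, f i ≤ m) (h : n * m = ∑ i ∈ s, f i) :
    s.card = n ∧ ∀ i ∈ s, f i = m := by
  have h1 : ∑ i ∈ s, f i ≤ s.card * m := by
    simpa using Finset.sum_le_sum hf
  have h2 : s.card = n := le_antisymm hs (Nat.le_of_mul_le_mul_right (h.trans_le h1) hm)
  refine ⟨h2, (Finset.sum_eq_sum_iff_of_le hf).1 ?_⟩
  rw [← h, Finset.sum_const, smul_eq_mul, h2]

variable {K : Type*} [Field K] [Fintype K] {q : ℕ}

theorem add_pow_of_card (hq : IsPrimePow q) (hK : Fintype.card K = q ^ 2) (a b : K) :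
    (a + b) ^ q = a ^ q + b ^ q := by
  obtain ⟨p, k, hp, hk, rfl⟩ := hq
  obtain ⟨p', hp'⟩ := CharP.exists K
  obtain ⟨n, hp'p, hn⟩ := FiniteField.card K p'
  have hpp : p' = p := by
    have h1 : p' ∣ (p ^ k) ^ 2 := by
      rw [← hK, hn]
      exact dvd_pow_self _ n.ne_zero
    exact (Nat.prime_dvd_prime_iff_eq hp'p hp.nat_prime).1
      (hp'p.dvd_of_dvd_pow (hp'p.dvd_of_dvd_pow h1))
  subst hpp
  have := Fact.mk hp'p
  exact add_pow_expChar_pow a b p' k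

theorem norm_pow (hK : Fintype.card K = q ^ 2) (a : K) : (a ^ (q + 1)) ^ q = a ^ (q + 1) := by
  have h := FiniteField.pow_card a
  rw [hK] at h
  calc (a ^ (q + 1)) ^ q = a ^ (q ^ 2) * a ^ q := by ring
    _ = a ^ (q + 1) := by rw [h]; ring

theorem trace_pow (hq : IsPrimePow q) (hK : Fintype.card K = q ^ 2) (b : K) :
    (b ^ q + b) ^ q = b ^ q + b := by
  have h := FiniteField.pow_card b
  rw [hK] at h
  rw [add_pow_of_card hq hK, ← pow_mul, ← sq, h, add_comm]

variable [DecidableEq K]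

theorem card_filter_eval_eq_zero_le {p : Polynomial K} (hp : p ≠ 0) :
    (Finset.univ.filter fun a => p.eval a = 0).card ≤ p.natDegree := by
  refine le_trans (Finset.card_le_card fun a ha => ?_)
    ((Multiset.toFinset_card_le _).trans p.card_roots')
  rw [Multiset.mem_toFinset, Polynomial.mem_roots hp]
  exact (Finset.mem_filter.1 ha).2

theorem card_fixed_le (hq : 2 ≤ q) :
    (Finset.univ.filter fun t : K => t ^ q = t).card ≤ q := by
  have hdeg : (Polynomial.X ^ q - Polynomial.X : Polynomial K).natDegree = q := by
    compute_degree!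
    · simp [show (1 : ℕ) ≠ q by omega]
    all_goals omega
  have hne : (Polynomial.X ^ q - Polynomial.X : Polynomial K) ≠ 0 := by
    intro h; rw [h] at hdeg; simp at hdeg; omega
  have := card_filter_eval_eq_zero_le hne
  rw [hdeg] at this
  simpa [sub_eq_zero] using this

theorem card_trace_fiber_le (hq : 2 ≤ q) (t : K) :
    (Finset.univ.filter fun b : K => b ^ q + b = t).card ≤ q := by
  have hdeg : (Polynomial.X ^ q + Polynomial.X - Polynomial.C t : Polynomial K).natDegree = q := by
    compute_degree!
    · simp [show q ≠ 0 by omega, show (1 : ℕ) ≠ q by omega]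
    all_goals omega
  have hne : (Polynomial.X ^ q + Polynomial.X - Polynomial.C t : Polynomial K) ≠ 0 := by
    intro h; rw [h] at hdeg; simp at hdeg; omega
  have := card_filter_eval_eq_zero_le hne
  rw [hdeg] at this
  simpa [sub_eq_zero] using this

theorem card_norm_fiber_le (t : K) :
    (Finset.univ.filter fun a : K => a ^ (q + 1) = t).card ≤ q + 1 := by
  have hne : (Polynomial.X ^ (q + 1) - Polynomial.C t : Polynomial K) ≠ 0 :=
    Polynomial.X_pow_sub_C_ne_zero q.succ_pos t
  have := card_filter_eval_eq_zero_le hne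
  rw [Polynomial.natDegree_X_pow_sub_C] at this
  simpa [sub_eq_zero] using this

/-- The `q ^ 2` elements of `K` fall into at most `q` fibres of at most `q` elements each. -/
theorem card_trace_fiber (hq : IsPrimePow q) (hK : Fintype.card K = q ^ 2) :
    (Finset.univ.filter fun t : K => t ^ q = t).card = q ∧ ∀ t : K, t ^ q = t →
      (Finset.univ.filter fun b : K => b ^ q + b = t).card = q := by
  have h := Finset.card_eq_sum_card_fiberwise (s := Finset.univ) (f := fun b : K => b ^ q + b)
    (t := Finset.univ.filter fun t : K => t ^ q = t)
    (fun b _ => by simpa using trace_pow hq hK b)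
  rw [Finset.card_univ, hK, sq] at h
  have h' := eq_of_sum_eq_mul hq.pos (card_fixed_le hq.two_le)
    (fun t _ => card_trace_fiber_le hq.two_le t) h
  exact ⟨h'.1, fun t ht => h'.2 t (by simpa using ht)⟩

theorem card_norm_fiber (hq : IsPrimePow q) (hK : Fintype.card K = q ^ 2) {t : K}
    (ht : t ^ q = t) (h0 : t ≠ 0) :
    (Finset.univ.filter fun a : K => a ^ (q + 1) = t).card = q + 1 := by
  set U := (Finset.univ.filter fun t : K => t ^ q = t).erase 0 with hU
  have hcU : U.card = q - 1 := by
    rw [hU, Finset.card_erase_of_mem (by simp [hq.ne_zero]), (card_trace_fiber hq hK).1]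
  have h := Finset.card_eq_sum_card_fiberwise (s := Finset.univ.erase 0)
    (f := fun a : K => a ^ (q + 1)) (t := U) (fun a ha => by
      have ha : a ≠ 0 := by simpa using ha
      simpa [hU, ha] using norm_pow hK a)
  rw [Finset.card_erase_of_mem (Finset.mem_univ _), Finset.card_univ, hK,
    show q ^ 2 - 1 = (q - 1) * (q + 1) by
      obtain ⟨r, rfl⟩ := Nat.exists_eq_add_of_le hq.pos
      simp only [Nat.add_sub_cancel_left]
      rw [Nat.sub_eq_iff_eq_add (Nat.pow_pos hq.pos)]; ring] at h
  have h' := (eq_of_sum_eq_mul q.succ_pos hcU.le (fun t _ =>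
    (Finset.card_le_card (Finset.filter_subset_filter _ (Finset.erase_subset _ _))).trans
      (card_norm_fiber_le t)) h).2 t (by simp [hU, h0, ht])
  refine le_antisymm (card_norm_fiber_le t) ?_
  refine h'.ge.trans ?_
  exact Finset.card_le_card (Finset.filter_subset_filter _ (Finset.erase_subset _ _))

end Counting

/-! ### Upper bounds: point sets on lines. -/

section Lines

variable {K : Type*} [Field K] {q : ℕ}

theorem onCurve_iff {D : Set (Fin 2 → K)} :
    OnCurve q D ↔ ∀ P ∈ D, P 0 ^ (q + 1) = P 1 ^ q + P 1 := by
  rw [OnCurve, mem_vanishingIdeal]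
  simp only [hermitianPoly, x, y, map_sub, map_add, map_pow, eval_X, sub_sub, sub_eq_zero]

/-- A set of elements of the semigroup, none of which is a proper translate by `d` of an element of
the semigroup, has at most `d` elements. -/
theorem card_le_of_sub_notMem_Lam {d : ℕ} (hd : 1 ≤ d) (hdL : (d : ℤ) ∈ Lam q) {Z : Finset ℕ}
    (h1 : ∀ z ∈ Z, (z : ℤ) ∈ Lam q) (h2 : ∀ z ∈ Z, (z : ℤ) - d ∉ Lam q) : Z.card ≤ d := by
  by_contra! hlt
  -- Two elements congruent modulo `d` would make the larger one, minus `d`, the smaller one plus a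
  -- multiple of `d`, hence an element of the semigroup.
  have key : ∀ z ∈ Z, ∀ z' ∈ Z, z < z' → z % d ≠ z' % d := by
    intro z hz z' hz' hzz h
    obtain ⟨k, hk⟩ := (Nat.modEq_iff_dvd' hzz.le).1 h
    have hk0 : k ≠ 0 := by
      rintro rfl
      rw [mul_zero] at hk
      omega
    obtain ⟨l, rfl⟩ := Nat.exists_eq_add_one_of_ne_zero hk0
    refine h2 z' hz' ?_
    have h3 : (z' : ℤ) - d = z + l • (d : ℤ) := by
      have : z' = z + d * (l + 1) := by omega
      rw [this, nsmul_eq_mul]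
      push_cast
      ring
    rw [h3]
    exact add_mem (h1 z hz) (nsmul_mem hdL l)
  obtain ⟨z, hz, z', hz', hne, h⟩ := Finset.exists_ne_map_eq_of_card_lt_of_maps_to
    (s := Z) (t := Finset.range d) (by simpa using hlt) (f := fun z => z % d)
    (fun z _ => by simpa using Nat.mod_lt _ hd)
  rcases lt_or_gt_of_ne hne with hl | hl
  · exact key z hz z' hz' hl h
  · exact key z' hz' z hz hl h.symm

/-- The points of a principal divisor of degree `d` on the Hermitian curve. -/
theorem exists_mem_footprint_of_divisor [Finite K] (hq : 2 ≤ q) {D : Set (Fin 2 → K)}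
    (hD : OnCurve q D) {r s : ℕ} (hd : 1 ≤ wt q (expo r s)) (hcard : wt q (expo r s) ≤ D.ncard)
    {f : MvPolynomial (Fin 2) K} (hf : f ∈ below q K (wt q (expo r s)))
    (hfD : monomial (expo r s) 1 - f ∈ vanishingIdeal K D) :
    D.ncard ≤ wt q (expo r s) ∧
      ∃ a ∈ footprint q D, wt q a + q + 1 = wt q (expo r s) + q ^ 2 := by
  classical
  set d := wt q (expo r s) with hd'
  have hsub : ∀ b ∈ footprint q D, (wt q b : ℤ) - d ∉ Lam q := by
    intro b hb hL
    obtain ⟨i, j, hij⟩ := exists_of_mem_Lam hL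
    have hwt : wt q (expo r s + expo i j) = wt q b := by
      rw [wt_add, ← hd', wt_expo]
      zify
      linarith
    refine notMem_footprint hq hD (b := expo r s + expo i j) (f := f * monomial (expo i j) 1)
      hwt.symm ?_ ?_ hb
    · rw [wt_add]
      exact mul_monomial_mem_below hf _
    · rw [monomial_mul_one, ← sub_mul]
      exact Ideal.mul_mem_right _ _ hfD
  have hfin := finite_footprint hq hD
  set Z := hfin.toFinset.image (wt q) with hZ
  have hZc : Z.card = D.ncard := by
    rw [hZ, Finset.card_image_of_injOn, ← Set.ncard_eq_toFinset_card _ hfin,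
      ncard_footprint hq hD]
    intro b hb c hc h
    rw [Finset.mem_coe, Set.Finite.mem_toFinset] at hb hc
    exact eq_of_wt_eq hb.1 hc.1 h
  have hdL : (d : ℤ) ∈ Lam q := wt_mem_Lam _
  have hZ1 : ∀ z ∈ Z, (z : ℤ) ∈ Lam q := by
    intro z hz
    obtain ⟨b, -, rfl⟩ := Finset.mem_image.1 hz
    exact wt_mem_Lam b
  have hZ2 : ∀ z ∈ Z, (z : ℤ) - d ∉ Lam q := by
    intro z hz
    obtain ⟨b, hb, rfl⟩ := Finset.mem_image.1 hz
    exact hsub b (by simpa using hb)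
  refine ⟨hZc ▸ card_le_of_sub_notMem_Lam hd hdL hZ1 hZ2, ?_⟩
  by_contra! hno
  have hle : q + 1 ≤ d + q ^ 2 := by nlinarith
  -- The weight `n = d + 2g - 1`, with `2g - 1 = q ^ 2 - q - 1`, is in `Λ` while `n - d` is not.
  -- Were it missing from `Z`, adding it would give more than `d` elements with these properties.
  obtain ⟨n, hn⟩ : ∃ n, n + q + 1 = d + q ^ 2 := ⟨d + q ^ 2 - (q + 1), by omega⟩
  have hnZ : n ∉ Z := by
    intro h
    obtain ⟨b, hb, rfl⟩ := Finset.mem_image.1 h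
    exact hno b (by simpa using hb) hn
  have hn' : (n : ℤ) = d + (q ^ 2 - q - 1) := by zify at hn; linarith
  have hneg : -(d : ℤ) ∉ Lam q := by
    intro h
    obtain ⟨i, j, hij⟩ := exists_of_mem_Lam h
    have : (0 : ℤ) ≤ i * q + j * (q + 1) := by positivity
    omega
  have hnL : (n : ℤ) ∈ Lam q := by
    rw [← mem_Lam_symm (by omega)] at hneg
    convert hneg using 1
    rw [hn']; ring
  have hnL' : (n : ℤ) - d ∉ Lam q := by
    rw [← mem_Lam_symm (by omega), hn', add_sub_cancel_left, sub_self]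
    exact zero_mem _
  have := card_le_of_sub_notMem_Lam (Z := insert n Z) hd hdL
    (by simpa [hnL] using hZ1) (by simpa [hnL'] using hZ2)
  rw [Finset.card_insert_of_notMem hnZ] at this
  omega

/-- With `P`, `Q` the two products, the difference is `(y ^ |T| - Q) * x ^ |S| + (x ^ |S| - P) * Q`.
-/
theorem pow_mul_pow_sub_prod_mem_below (hq : 1 ≤ q) (S T : Finset K) :
    monomial (expo S.card T.card) (1 : K) - (∏ a ∈ S, (x K - C a)) * ∏ b ∈ T, (y K - C b) ∈
      below q K (wt q (expo S.card T.card)) := by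
  set p := ∏ b ∈ T, (y K - C b) with hp
  have h1 := prod_X_sub_C_sub_mem_below (q := q) 0 hq S
  have h2 := prod_X_sub_C_sub_mem_below (q := q) 1 hq T
  have e1 : S.card * wt q (Finsupp.single 0 1) = wt q (expo S.card 0) := by simp [wt_eq]
  have e2 : T.card * wt q (Finsupp.single 1 1) = wt q (expo 0 T.card) := by simp [wt_eq]
  rw [e1] at h1
  rw [e2] at h2
  have h3 := mul_monomial_mem_below h2 (expo S.card 0)
  rw [← wt_add, expo_add, zero_add, add_zero] at h3
  have hp1 : p ∈ restrictSupport K {a | wt q a ≤ wt q (expo 0 T.card)} := by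
    have h4 : (X 1 : MvPolynomial (Fin 2) K) ^ T.card ∈
        restrictSupport K {a | wt q a ≤ wt q (expo 0 T.card)} := by
      rw [X_pow_eq_monomial]
      refine (monomial_mem_restrictSupport K).2 (Or.inl ?_)
      simp [wt_eq]
    have h5 : _ ∈ restrictSupport K {a | wt q a ≤ wt q (expo 0 T.card)} :=
      restrictSupport_mono _ (fun a (ha : wt q a < _) => ha.le) h2
    simpa using sub_mem h4 h5
  have h6 := Submodule.mul_mem_mul h1 hp1
  rw [below, ← restrictSupport_add] at h6
  have h7 : _ ∈ below q K (wt q (expo S.card T.card)) := restrictSupport_mono _ (by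
    rintro _ ⟨a, ha, b, hb, rfl⟩
    simp only [Set.mem_ofPred_eq, wt_add, wt_expo] at ha hb ⊢
    omega) h6
  convert add_mem h3 h7 using 1
  simp only [monomial_expo, x, y]
  ring

variable [Fintype K]

/-- The points of the Hermitian curve on vertical lines and horizontal lines without common points
on the curve. -/
theorem exists_of_lines (hq : IsPrimePow q) (hK : Fintype.card K = q ^ 2) {S T : Finset K}
    (hST : ∀ a ∈ S, ∀ b ∈ T, a ^ (q + 1) ≠ b ^ q + b) (hT : ∀ b ∈ T, b ^ q + b ≠ 0)
    (hd : 1 ≤ wt q (expo S.card T.card)) :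
    ∃ D : Set (Fin 2 → K), OnCurve q D ∧ D.ncard ≤ wt q (expo S.card T.card) ∧
      ∃ a ∈ footprint q D, wt q a + q + 1 = wt q (expo S.card T.card) + q ^ 2 := by
  classical
  set D1 : Finset (Fin 2 → K) :=
    Finset.univ.filter fun P => P 0 ^ (q + 1) = P 1 ^ q + P 1 ∧ P 0 ∈ S with hD1
  set D2 : Finset (Fin 2 → K) :=
    Finset.univ.filter fun P => P 0 ^ (q + 1) = P 1 ^ q + P 1 ∧ P 1 ∈ T with hD2
  have hdisj : Disjoint D1 D2 := by
    rw [Finset.disjoint_left]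
    intro P h1 h2
    simp only [hD1, hD2, Finset.mem_filter, Finset.mem_univ, true_and] at h1 h2
    exact hST _ h1.2 _ h2.2 h1.1
  -- A vertical line carries `q` curve points and a horizontal line of nonzero trace `q + 1`, so the
  -- lines give at least as many points as the leading weight of the product of their equations.
  have hc1 : S.card * q ≤ D1.card := by
    have h : (S.sigma fun a => Finset.univ.filter fun b : K => b ^ q + b = a ^ (q + 1)).card =
        S.card * q := by
      rw [Finset.card_sigma, Finset.sum_congr rfl fun a _ =>
        (card_trace_fiber hq hK).2 _ (norm_pow hK a), Finset.sum_const, smul_eq_mul]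
    rw [← h]
    refine Finset.card_le_card_of_injOn (fun p => ![p.1, p.2]) ?_ ?_
    · rintro ⟨a, b⟩ hab
      simp only [Finset.coe_sigma, Set.mem_sigma_iff, Finset.mem_coe, Finset.mem_filter,
        Finset.mem_univ, true_and] at hab
      simp [hD1, hab.1, hab.2]
    · rintro ⟨a, b⟩ - ⟨a', b'⟩ - h
      have h0 := congrFun h 0
      have h1 := congrFun h 1
      simp only [Matrix.cons_val_zero, Matrix.cons_val_one] at h0 h1
      rw [h0, h1]
  have hc2 : T.card * (q + 1) ≤ D2.card := by
    have h : (T.sigma fun b => Finset.univ.filter fun a : K => a ^ (q + 1) = b ^ q + b).card =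
        T.card * (q + 1) := by
      rw [Finset.card_sigma, Finset.sum_congr rfl fun b hb =>
        card_norm_fiber hq hK (trace_pow hq hK b) (hT b hb), Finset.sum_const, smul_eq_mul]
    rw [← h]
    refine Finset.card_le_card_of_injOn (fun p => ![p.2, p.1]) ?_ ?_
    · rintro ⟨b, a⟩ hab
      simp only [Finset.coe_sigma, Set.mem_sigma_iff, Finset.mem_coe, Finset.mem_filter,
        Finset.mem_univ, true_and] at hab
      simp [hD2, hab.1, hab.2]
    · rintro ⟨a, b⟩ - ⟨a', b'⟩ - h
      have h0 := congrFun h 0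
      have h1 := congrFun h 1
      simp only [Matrix.cons_val_zero, Matrix.cons_val_one] at h0 h1
      rw [h0, h1]
  have hD : OnCurve q (↑(D1 ∪ D2) : Set (Fin 2 → K)) := by
    rw [onCurve_iff]
    intro P hP
    simp only [hD1, hD2, Finset.coe_union, Set.mem_union, Finset.mem_coe, Finset.mem_filter,
      Finset.mem_univ, true_and] at hP
    rcases hP with hP | hP <;> exact hP.1
  refine ⟨_, hD, exists_mem_footprint_of_divisor hq.two_le hD hd ?_
    (pow_mul_pow_sub_prod_mem_below hq.pos S T) ?_⟩
  · rw [Set.ncard_coe_finset, Finset.card_union_of_disjoint hdisj, wt_expo]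
    omega
  · rw [sub_sub_cancel, mem_vanishingIdeal]
    intro P hP
    simp only [hD1, hD2, Finset.coe_union, Set.mem_union, Finset.mem_coe, Finset.mem_filter,
      Finset.mem_univ, true_and] at hP
    rw [map_mul, map_prod, map_prod, mul_eq_zero]
    rcases hP with hP | hP
    · exact Or.inl (Finset.prod_eq_zero hP.2 (by simp [x]))
    · exact Or.inr (Finset.prod_eq_zero hP.2 (by simp [y]))

/-- The Goppa bound is attained. -/
theorem exists_of_mem_Lam_of_sub_mem_Lam (hq : IsPrimePow q) (hK : Fintype.card K = q ^ 2)
    {r s : ℕ} (hr : r ≤ q) (hd : 1 ≤ wt q (expo r s))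
    (hL : (q : ℤ) ^ 3 - wt q (expo r s) ∈ Lam q) :
    ∃ D : Set (Fin 2 → K), OnCurve q D ∧ D.ncard ≤ wt q (expo r s) ∧
      ∃ a ∈ footprint q D, wt q a + q + 1 = wt q (expo r s) + q ^ 2 := by
  classical
  have hq2 := hq.two_le
  obtain ⟨hF, htr⟩ := card_trace_fiber hq hK
  have hle : wt q (expo r s) ≤ q ^ 3 := by
    obtain ⟨i, j, hij⟩ := exists_of_mem_Lam hL
    have : (0 : ℤ) ≤ i * q + j * (q + 1) := by positivity
    zify
    linarith
  rw [wt_expo] at hle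
  -- At most one vertical line: take `x = 0`, which only excludes the horizontal lines of trace `0`.
  -- Otherwise take vertical lines of norm `1`, which also excludes trace `1`; there are `q + 1 ≥ r`
  -- of them.
  rcases le_or_gt r 1 with hr1 | hr1
  · have hcard : s ≤ (Finset.univ.filter fun b : K => ¬ b ^ q + b = 0).card := by
      have h1 := Finset.card_filter_add_card_filter_not (s := Finset.univ)
        (fun b : K => b ^ q + b = 0)
      rw [htr 0 (by simp [hq.ne_zero]), Finset.card_univ, hK] at h1
      have h2 : s ≤ q ^ 2 - q := by
        by_contra! h2
        have h3 : q ^ 2 + 1 ≤ s + q := by omega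
        nlinarith
      omega
    obtain ⟨T, hT, rfl⟩ := Finset.exists_subset_card_eq hcard
    have hT' : ∀ b ∈ T, b ^ q + b ≠ 0 := fun b hb => by simpa using hT hb
    obtain ⟨S, hS, rfl⟩ := Finset.exists_subset_card_eq (s := {(0 : K)}) (n := r)
      (by simpa using hr1)
    refine exists_of_lines hq hK (fun a ha b hb => ?_) hT' hd
    rw [Finset.mem_singleton.1 (hS ha), zero_pow q.succ_ne_zero]
    exact (hT' b hb).symm
  · have hcard : s ≤ (Finset.univ.filter fun b : K => ¬ (b ^ q + b = 0 ∨ b ^ q + b = 1)).card := by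
      have h1 := Finset.card_filter_add_card_filter_not (s := Finset.univ)
        (fun b : K => b ^ q + b = 0 ∨ b ^ q + b = 1)
      rw [Finset.filter_or, Finset.card_union_of_disjoint, htr 0 (by simp [hq.ne_zero]),
        htr 1 (one_pow _), Finset.card_univ, hK] at h1
      · have h2 : s + 2 * q ≤ q ^ 2 := by
          by_contra! h2
          -- If `q ^ 2 - 2 * q < s ≤ q ^ 2 - q`, this is division by `q` with remainder, and
          -- membership in `Λ` would give `r ≤ 1`.
          have h3 : (q : ℤ) ^ 3 - wt q (expo r s) =
              (q ^ 2 - q + 1 - s - r) * q + (q ^ 2 - q - s) := by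
            rw [wt_expo]; push_cast; ring
          rcases le_or_gt (s + q) (q ^ 2) with h4 | h4
          · rw [h3, mem_Lam_iff (by zify at h4; linarith) (by zify at h2; linarith)] at hL
            omega
          · zify at *
            nlinarith
        omega
      · rw [Finset.disjoint_left]
        intro b h1 h2
        rw [Finset.mem_filter] at h1 h2
        exact zero_ne_one (h1.2.symm.trans h2.2)
    obtain ⟨T, hT, rfl⟩ := Finset.exists_subset_card_eq hcard
    have hT' : ∀ b ∈ T, b ^ q + b ≠ 0 ∧ b ^ q + b ≠ 1 := fun b hb => by
      simpa using hT hb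
    obtain ⟨S, hS, rfl⟩ := Finset.exists_subset_card_eq (n := r) (by
      rw [card_norm_fiber hq hK (one_pow q) one_ne_zero]
      omega)
    refine exists_of_lines hq hK (fun a ha b hb => ?_) (fun b hb => (hT' b hb).1) hd
    rw [(Finset.mem_filter.1 (hS ha)).2]
    exact (hT' b hb).2.symm

/-- On `x = 0` only powers of `y` can be in the footprint. The `h + 1` points need `h + 1` of them,
so some exponent is at least `h`. -/
theorem exists_on_vertical_line (hq : IsPrimePow q) (hK : Fintype.card K = q ^ 2)
    {h n : ℕ} (hh : h < q) (hn : n ≤ h * (q + 1)) :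
    ∃ D : Set (Fin 2 → K), OnCurve q D ∧ D.ncard = h + 1 ∧ ∃ a ∈ footprint q D, n ≤ wt q a := by
  classical
  have hq2 := hq.two_le
  obtain ⟨T, hT, hTc⟩ := Finset.exists_subset_card_eq (n := h + 1)
    (show h + 1 ≤ (Finset.univ.filter fun b : K => b ^ q + b = 0).card by
      rw [(card_trace_fiber hq hK).2 0 (by simp [hq.ne_zero])]; omega)
  have hinj : Function.Injective fun b : K => (![0, b] : Fin 2 → K) := fun b c hbc => by
    simpa using congrFun hbc 1
  set D : Set (Fin 2 → K) := (fun b => ![0, b]) '' (T : Set K)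
  have hD : OnCurve q D := by
    rw [onCurve_iff]
    rintro _ ⟨b, hb, rfl⟩
    simpa using (Finset.mem_filter.1 (hT hb)).2.symm
  have hDc : D.ncard = h + 1 := by
    rw [Set.ncard_image_of_injective _ hinj, Set.ncard_coe_finset, hTc]
  refine ⟨D, hD, hDc, ?_⟩
  by_contra! hno
  have hsub : footprint q D ⊆ (fun j => expo 0 j) '' (Finset.range h : Set ℕ) := by
    intro a ha
    have h0 : a 0 = 0 := by
      by_contra h0
      refine notMem_footprint hq2 hD (a := a) (b := a) (f := 0) rfl (zero_mem _) ?_ ha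
      rw [sub_zero, mem_vanishingIdeal]
      rintro _ ⟨b, -, rfl⟩
      rw [← expo_eta a, monomial_expo]
      simp [x, h0]
    have h1 := hno a ha
    rw [wt_eq, h0] at h1
    refine ⟨a 1, ?_, exponent_ext (by simp [h0]) (by simp)⟩
    rw [Finset.coe_range, Set.mem_Iio]
    by_contra! h2
    have := Nat.mul_le_mul_right (q + 1) h2
    omega
  have h1 := Set.ncard_le_ncard hsub ((Finset.finite_toSet _).image _)
  have h2 := Set.ncard_image_le (f := fun j => expo 0 j) (Finset.range h).finite_toSet
  rw [Set.ncard_coe_finset, Finset.card_range] at h2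
  rw [ncard_footprint hq2 hD, hDc] at h1
  omega

end Lines

/-! ### Minimum-weight supports and the three ranges of `m`. -/

section Minimal

variable {K : Type*} [Field K] {q n : ℕ} {D : Set (Fin 2 → K)}

/-- `D` has the least number of points among the sets of points of the Hermitian curve on which the
polynomials of weighted degree less than `n` do not take all values. -/
def IsMinimalSupport (q n : ℕ) (D : Set (Fin 2 → K)) : Prop :=
  OnCurve q D ∧ (∃ a ∈ footprint q D, n ≤ wt q a) ∧
    ∀ D' : Set (Fin 2 → K), OnCurve q D' → (∃ a ∈ footprint q D', n ≤ wt q a) → D.ncard ≤ D'.ncard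

theorem IsMinWeight.isMinimalSupport [Fintype K] [DecidableEq K] (hq : 2 ≤ q) {m : ℕ}
    {c : Point q K → K} (hc : IsMinWeight (code q K m) c) :
    IsMinimalSupport q (m + 1) (HermitianCode.support c) := by
  obtain ⟨hcode, hc0, hmin⟩ := hc
  have hD : OnCurve q (HermitianCode.support c) := by
    rw [OnCurve, mem_vanishingIdeal]
    rintro _ ⟨P, -, rfl⟩
    exact P.2
  have hcard : (HermitianCode.support c).ncard = hammingNorm c := by
    rw [HermitianCode.support, Set.ncard_image_of_injective _ Subtype.val_injective, hammingNorm,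
      ← Set.ncard_coe_finset]
    congr 1
    ext P
    simp
  refine ⟨hD, ?_, ?_⟩
  · by_contra! hno
    obtain ⟨P₀, hP₀⟩ := Function.ne_iff.1 hc0
    -- If all footprint weights were at most `m`, the indicator of a support point would be given by
    -- a polynomial of weight at most `m`; orthogonality of `c` to it kills `c` at that point.
    obtain ⟨f, hf, hfv⟩ := exists_footprint_evalOn_eq hq hD
      (fun P => if P.1 = P₀.1 then 1 else 0)
    have hspan : f ∈ Submodule.span K
        {f | ∃ r s : ℕ, wDeg q r s ≤ m ∧ f = x K ^ r * y K ^ s} := by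
      refine restrictSupport_le (fun a ha => ?_) hf
      refine Submodule.subset_span ⟨a 0, a 1, Nat.lt_succ_iff.1 (hno a ha), ?_⟩
      rw [← monomial_expo, expo_eta]
    have h := hcode _ (Submodule.mem_map_of_mem hspan)
    rw [Finset.sum_eq_single P₀] at h
    · have h1 := congrFun hfv ⟨P₀.1, ⟨P₀, hP₀, rfl⟩⟩
      have h2 : eval P₀.1 f = 1 := by simpa [evalOn] using h1
      refine hP₀ ?_
      simpa [evalPoints, h2] using h
    · intro P _ hne
      by_cases hP : c P = 0
      · rw [hP, mul_zero]
      · have h1 := congrFun hfv ⟨P.1, ⟨P, hP, rfl⟩⟩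
        have h2 : eval P.1 f = 0 := by
          simpa [evalOn, Subtype.val_injective.eq_iff, hne] using h1
        simp [evalPoints, h2]
    · simp
  · rintro D' hD' ⟨a, ha, hma⟩
    set W := (Submodule.span K {f | ∃ r s : ℕ, wDeg q r s ≤ m ∧ f = x K ^ r * y K ^ s}).map
      (evalOn D') with hW
    have hlt : W < ⊤ := by
      rw [lt_top_iff_ne_top]
      intro htop
      have hmem : evalOn D' (monomial a 1) ∈ W := by rw [htop]; trivial
      obtain ⟨f, hf, hfa⟩ := Submodule.mem_map.1 hmem
      refine notMem_footprint hq hD' (a := a) (b := a) (f := f) rfl ?_ ?_ ha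
      · refine (Submodule.span_le.2 ?_ : _ ≤ below q K (wt q a)) hf
        rintro _ ⟨r, s, hrs, rfl⟩
        rw [← monomial_expo]
        refine monomial_mem_below ?_ 1
        rw [wt_expo]
        exact lt_of_le_of_lt hrs hma
      · rw [← evalOn_eq_zero, map_sub, hfa, sub_self]
    -- Since polynomials of weight at most `m` miss some function on `D'`, a nonzero functional
    -- annihilates their values. Its coefficients, extended by zero, form a codeword supported in
    -- `D'`.
    obtain ⟨φ, hφ0, hφ⟩ := Submodule.exists_dual_map_eq_bot_of_lt_top hlt inferInstance
    classical
    have := Fintype.ofFinite D'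
    rw [OnCurve, mem_vanishingIdeal] at hD'
    set ι : D' → Point q K := fun P => ⟨P.1, hD' P.1 P.2⟩ with hι
    have hιi : Function.Injective ι := fun P Q h => Subtype.ext (congrArg (fun R => R.1) h)
    have hφs : ∀ g : D' → K, φ g = ∑ i, g i * φ (Pi.single i 1) := by
      intro g
      rw [LinearMap.pi_apply_eq_sum_univ φ g]
      refine Finset.sum_congr rfl fun i _ => ?_
      rw [smul_eq_mul]
      congr 2
      ext j
      simp [Pi.single_apply, eq_comm]
    set c' : Point q K → K := Function.extend ι (fun i => φ (Pi.single i 1)) 0 with hc'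
    have hc'ι : ∀ i, c' (ι i) = φ (Pi.single i 1) := fun i => hιi.extend_apply _ _ _
    have hc'0 : ∀ P ∉ Set.range ι, c' P = 0 := fun P hP =>
      Function.extend_apply' _ _ _ (by simpa using hP)
    have hmem : c' ∈ code q K m := by
      rintro _ ⟨f, hf, rfl⟩
      have h1 : φ (evalOn D' f) = 0 := by
        have h2 : φ (evalOn D' f) ∈ W.map φ :=
          Submodule.mem_map_of_mem (Submodule.mem_map_of_mem hf)
        exact (Submodule.mem_bot K).1 (hφ ▸ h2)
      rw [hφs] at h1
      rw [← h1]
      refine (Fintype.sum_of_injective ι hιi _ _ (fun P hP => ?_) fun i => ?_).symm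
      · rw [hc'0 P hP, mul_zero]
      · rw [hc'ι]
        rfl
    have hne : c' ≠ 0 := by
      intro h
      refine hφ0 (LinearMap.ext fun g => ?_)
      rw [hφs, LinearMap.zero_apply]
      refine Finset.sum_eq_zero fun i _ => ?_
      rw [← hc'ι, h, Pi.zero_apply, mul_zero]
    rw [hcard]
    refine (hmin c' hmem hne).trans ?_
    rw [hammingNorm, ← Set.ncard_coe_finset, ← Set.ncard_image_of_injective _ Subtype.val_injective]
    refine Set.ncard_le_ncard ?_ (Set.toFinite _)
    rintro _ ⟨P, hP, rfl⟩
    by_contra h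
    have hP : c' P ≠ 0 := by simpa using hP
    refine hP (hc'0 P ?_)
    rintro ⟨i, rfl⟩
    exact h i.2

/-- The equations `x ^ (q ^ 2) = x` and `y ^ (q ^ 2) = y` hold at all points and remove all other
reduced exponents. -/
theorem wt_mem_LamB [Fintype K] (hq : 2 ≤ q) (hK : Fintype.card K = q ^ 2) (hD : OnCurve q D)
    {a : Fin 2 →₀ ℕ} (ha : a ∈ footprint q D) : wt q a ∈ LamB q := by
  have hpow : ∀ u : K, u ^ (q ^ 2) = u := fun u => by rw [← hK, FiniteField.pow_card]
  have h1 : a 1 < q ^ 2 := by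
    by_contra! h
    obtain ⟨t, ht⟩ := Nat.exists_eq_add_of_le h
    refine notMem_footprint hq hD (a := a) (b := a) (f := monomial (expo (a 0) (t + 1)) 1) rfl
      (monomial_mem_below ?_ 1) ?_ ha
    · rw [wt_expo, wt_eq, ht]
      have : (t + 1) * (q + 1) < (q ^ 2 + t) * (q + 1) :=
        Nat.mul_lt_mul_of_pos_right (by nlinarith) q.succ_pos
      omega
    · rw [mem_vanishingIdeal]
      intro P _
      rw [← expo_eta a, ht, monomial_expo, monomial_expo]
      simp only [expo_zero, x, y, map_sub, map_mul, map_pow, eval_X]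
      rw [pow_add, hpow, pow_succ]
      ring
  refine ⟨a 0, a 1, ?_, rfl⟩
  by_cases h0 : a 0 = 0
  · rcases lt_or_ge (a 1 + q) (q ^ 2) with h | h
    · exact Or.inl ⟨ha.1, h⟩
    · exact Or.inr ⟨h0, h, h1⟩
  · refine Or.inl ⟨ha.1, ?_⟩
    by_contra! h
    obtain ⟨t, ht⟩ := Nat.exists_eq_add_of_le h
    obtain ⟨r, hr⟩ := Nat.exists_eq_add_one_of_ne_zero h0
    -- Trading `y ^ q` for `x ^ (q + 1)` in the weight exposes a factor `x ^ (q ^ 2)`.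
    have hwt : wt q a = wt q (expo (r + q ^ 2) t) := by
      rw [wt_expo, wt_eq, hr]
      zify at ht ⊢
      linear_combination ((q : ℤ) + 1) * ht
    refine notMem_footprint hq hD (a := a) (b := expo (r + q ^ 2) t)
      (f := monomial (expo (r + 1) t) 1) hwt (monomial_mem_below ?_ 1) ?_ ha
    · rw [wt_expo, wt_expo]
      have : (r + 1) * q < (r + q ^ 2) * q :=
        Nat.mul_lt_mul_of_pos_right (by nlinarith) (by omega)
      omega
    · rw [mem_vanishingIdeal]
      intro P _
      rw [monomial_expo, monomial_expo]
      simp only [x, y, map_sub, map_mul, map_pow, eval_X]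
      rw [pow_add, hpow, pow_succ]
      ring

/-- Footprint weights of subsets are among those of the full curve, so `n` can be raised to the next
such weight without changing the condition. This covers unlabelled `m`. -/
theorem IsMinimalSupport.exists_mem_LamB [Fintype K] (hq : 2 ≤ q) (hK : Fintype.card K = q ^ 2)
    (h : IsMinimalSupport q n D) : ∃ n' ∈ LamB q, n ≤ n' ∧ IsMinimalSupport q n' D := by
  set E : Set (Fin 2 → K) := {P | P 0 ^ (q + 1) = P 1 ^ q + P 1}
  have hE : OnCurve q E := onCurve_iff.2 fun P hP => hP
  have hsub : ∀ D' : Set (Fin 2 → K), OnCurve q D' → footprint q D' ⊆ footprint q E :=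
    fun D' hD' => footprint_mono q fun P hP => onCurve_iff.1 hD' P hP
  obtain ⟨hD, ⟨a, ha, hna⟩, hmin⟩ := h
  have hex : ∃ k, ∃ b ∈ footprint q E, n ≤ wt q b ∧ wt q b = k :=
    ⟨_, a, hsub D hD ha, hna, rfl⟩
  classical
  obtain ⟨b, hb, hnb, hbk⟩ := Nat.find_spec hex
  have hleast : ∀ b' ∈ footprint q E, n ≤ wt q b' → wt q b ≤ wt q b' := fun b' hb' hn' => by
    rw [hbk]
    exact Nat.find_min' hex ⟨b', hb', hn', rfl⟩
  refine ⟨wt q b, wt_mem_LamB hq hK hE hb, hnb, hD, ⟨a, ha, hleast a (hsub D hD ha) hna⟩, ?_⟩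
  rintro D' hD' ⟨a', ha', hn'⟩
  exact hmin D' hD' ⟨a', ha', hnb.trans hn'⟩

/-- The difference equals `(q ^ 2 - 1) * (q + 1) - n`, and `(q ^ 2 - 1) * (q + 1)` is the largest
element of `LamB q`. -/
theorem sub_mem_Lam_of_mem_LamB {r s : ℕ} (hn : n ∈ LamB q)
    (h : n + q + 1 = wt q (expo r s) + q ^ 2) : (q : ℤ) ^ 3 - wt q (expo r s) ∈ Lam q := by
  obtain ⟨i, j, hij, rfl⟩ := hn
  have h' : (wt q (expo r s) : ℤ) = i * q + j * (q + 1) + q + 1 - q ^ 2 := by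
    rw [wDeg] at h
    zify at h ⊢
    linarith
  rw [h']
  rcases hij with ⟨hi, hj⟩ | ⟨rfl, hj, hjq⟩
  · convert natCast_mem_Lam (q := q) (q + 1 - i) (q ^ 2 - 1 - (j + q)) using 1
    rw [Nat.cast_sub (by omega), Nat.cast_sub (by omega), Nat.cast_sub (by omega)]
    push_cast
    ring
  · convert natCast_mem_Lam (q := q) 0 (q ^ 2 - 1 - j) using 1
    rw [Nat.cast_sub (by omega), Nat.cast_sub (by omega)]
    push_cast
    ring

variable [Fintype K]

theorem IsMinimalSupport.exists_lines (hq : IsPrimePow q) (hK : Fintype.card K = q ^ 2)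
    (h : IsMinimalSupport q n D) (hn : n ∈ LamB q) (hn0 : 1 ≤ n) (hnq : n + 1 ≤ q ^ 2) :
    ∃ h : ℕ, 1 ≤ h ∧ h < q ∧ h * q ≤ n ∧ n ≤ h * (q + 1) ∧
      ((∃ (u : K) (T : Finset K), T.card = h + 1 ∧
        IsIntersection D (x K - C u) (∏ b ∈ T, (y K - C b))) ∨
      (n = h * q ∧ ∃ (u v : K) (T : Finset K), (u ≠ 0 ∨ v ≠ 0) ∧ T.card = h + 1 ∧
        IsIntersection D (y K - C u * x K - C v) (∏ a ∈ T, (x K - C a)))) := by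
  have hq2 := hq.two_le
  obtain ⟨hD, ⟨a, ha, hna⟩, hmin⟩ := h
  obtain ⟨r, s, -, rfl⟩ := hn
  rw [wDeg] at *
  have h1 : (r + s) * q ≤ r * q + s * (q + 1) := by nlinarith
  have h2 : r * q + s * (q + 1) ≤ (r + s) * (q + 1) := by nlinarith
  have hhq : r + s < q := by
    by_contra! hle
    have := Nat.mul_le_mul_right q hle
    nlinarith
  have hh1 : 1 ≤ r + s := by
    by_contra! h0
    obtain ⟨rfl, rfl⟩ : r = 0 ∧ s = 0 := by omega
    simp at hn0
  generalize r + s = h at *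
  obtain ⟨D', hD', hc', a', ha', hn'⟩ := exists_on_vertical_line hq hK hhq h2
  have hDc := (hmin D' hD' ⟨a', ha', hn'⟩).trans hc'.le
  have hbox := card_boxes_le_ncard hq2 hD ha
  -- The box below `a` has at least `(a 0 + 1) * (a 1 + 1)` elements and at most `h + 1` fit, while
  -- `wt q a ≥ h * q` gives `a 0 + a 1 ≥ h`. So `a` is a power of one variable.
  have hsum : a 0 + a 1 ≤ h ∧ a 0 * a 1 = 0 ∨ h < a 0 + a 1 := by
    rcases le_or_gt (a 0 + a 1) h with hle | hlt
    · left
      refine ⟨hle, ?_⟩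
      have hge : h ≤ a 0 + a 1 := by
        by_contra! hlt
        have h3 := Nat.mul_le_mul_right q hlt
        rw [wt_eq] at hna
        nlinarith
      nlinarith
    · exact Or.inr hlt
  have hlt : ¬ h < a 0 + a 1 := fun hlt => by nlinarith
  obtain ⟨hle, h0⟩ := hsum.resolve_right hlt
  have hge : h ≤ a 0 + a 1 := by
    by_contra! hlt
    have h3 := Nat.mul_le_mul_right q hlt
    rw [wt_eq] at hna
    nlinarith
  have hfp := footprint_eq_boxes hq2 hD ha (by nlinarith)
  have hcard : h + 1 < Fintype.card K := by rw [hK]; nlinarith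
  refine ⟨h, hh1, hhq, h1, h2, ?_⟩
  have himg : ∀ i j, i ≤ q → (expo i j ∈ footprint q D ↔ i ≤ a 0 ∧ j ≤ a 1) := by
    intro i j hi
    rw [hfp]
    constructor
    · rintro ⟨p, hp, hpe⟩
      obtain rfl : p = (i, j) := expo_injective hpe
      simp only [boxes, Finset.coe_union, Finset.coe_product, Set.mem_union, Set.mem_prod,
        Finset.mem_coe, Finset.mem_range, Finset.mem_Ioc] at hp
      omega
    · intro hij
      refine ⟨(i, j), ?_, rfl⟩
      simp only [boxes, Finset.coe_union, Finset.coe_product, Set.mem_union, Set.mem_prod,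
        Finset.mem_coe, Finset.mem_range, Finset.mem_Ioc]
      omega
  rcases Nat.mul_eq_zero.1 h0 with h0 | h0
  · left
    refine exists_isIntersection_vertical hq2 hcard hD (Set.ext fun b => ?_)
    constructor
    · intro hb
      have h3 := hb
      rw [← expo_eta b, himg _ _ hb.1] at h3
      exact ⟨b 1, by rw [Set.mem_Iic]; omega, exponent_ext (by simp; omega) (by simp)⟩
    · rintro ⟨j, hj, rfl⟩
      rw [Set.mem_Iic] at hj
      rw [himg _ _ (Nat.zero_le _)]
      omega
  · right
    have h4 : a 0 = h := by omega
    refine ⟨?_, exists_isIntersection_line hq2 hcard hh1 hD (Set.ext fun b => ?_)⟩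
    · rw [wt_eq, h0, h4] at hna
      omega
    constructor
    · intro hb
      have h3 := hb
      rw [← expo_eta b, himg _ _ hb.1] at h3
      exact ⟨b 0, by rw [Set.mem_Iic]; omega, exponent_ext (by simp) (by simp; omega)⟩
    · rintro ⟨j, hj, rfl⟩
      rw [Set.mem_Iic] at hj
      rw [himg _ _ (by omega)]
      omega

theorem IsMinimalSupport.exists_hermitianPoly (hq : IsPrimePow q) (hK : Fintype.card K = q ^ 2)
    (h : IsMinimalSupport q n D) (hn : n ∈ LamB q) {r s : ℕ} (hr : r ≤ q)
    (hd : 1 ≤ wt q (expo r s)) (hnd : n + q + 1 = wt q (expo r s) + q ^ 2) :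
    ∃ F : MvPolynomial (Fin 2) K, HasLeadingMonomial F r s ∧
      IsIntersection D (hermitianPoly q K) F := by
  have hq2 := hq.two_le
  obtain ⟨hD, ⟨a, ha, hna⟩, hmin⟩ := h
  classical
  obtain ⟨D', hD', hc', a', ha', hw'⟩ :=
    exists_of_mem_Lam_of_sub_mem_Lam hq hK hr hd (sub_mem_Lam_of_mem_LamB hn hnd)
  have hDc := (hmin D' hD' ⟨a', ha', by omega⟩).trans hc'
  have hle := wt_le_ncard hq2 hD ha
  obtain ⟨F, hF, hFD⟩ := exists_vanishingIdeal_eq_span_hermitianPoly hq2 hD ha hr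
    (by omega) hDc
  refine ⟨F, hF, totalDegree_hermitianPoly_ne_zero, hF.totalDegree_ne_zero ?_, hFD⟩
  intro h0
  obtain ⟨rfl, rfl⟩ : r = 0 ∧ s = 0 := by omega
  simp at hd

theorem IsMinimalSupport.exists_of_gap (hq : IsPrimePow q) (hK : Fintype.card K = q ^ 2)
    (h : IsMinimalSupport q n D) {μ t : ℕ} (hμ : 1 ≤ μ) (hμq : μ < q) (ht : 1 ≤ t)
    (htμ : t + μ ≤ q) (hnd : n + q + 1 = (μ - 1) * (q + 1) + t + q ^ 2) :
    (∃ F : MvPolynomial (Fin 2) K, HasLeadingMonomial F μ 0 ∧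
      IsIntersection D (hermitianPoly q K) F) ∨
    (t = 1 ∧ ∃ F₁ F₂ : MvPolynomial (Fin 2) K,
      HasLeadingMonomial F₁ q 0 ∧ HasLeadingMonomial F₂ 0 μ ∧ IsIntersection D F₁ F₂) := by
  have hq2 := hq.two_le
  obtain ⟨hD, ⟨a, ha, hna⟩, hmin⟩ := h
  obtain ⟨k, rfl⟩ : ∃ k, μ = k + 1 := ⟨μ - 1, by omega⟩
  rw [Nat.add_sub_cancel] at hnd
  obtain ⟨S, -, hS⟩ := Finset.exists_subset_card_eq (s := (Finset.univ : Finset K)) (n := k + 1)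
    (by rw [Finset.card_univ, hK]; nlinarith)
  -- All curve points on `μ` vertical lines: `μ * q` points, the next attainable value above the
  -- gap.
  obtain ⟨D', hD', hc', a', ha', hw'⟩ := exists_of_lines hq hK (S := S) (T := ∅) (by simp)
    (by simp) (by rw [hS, wt_expo]; nlinarith)
  rw [hS, Finset.card_empty] at hc' hw'
  have hwk : wt q (expo (k + 1) 0) = (k + 1) * q := by simp
  have hDc := (hmin D' hD' ⟨a', ha', by rw [hwk] at hw'; nlinarith⟩).trans hc'
  have hle := wt_le_ncard hq2 hD ha
  rcases eq_or_lt_of_le (hle.trans (Nat.add_le_add_right hDc _)) with heq | hlt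
  · left
    obtain ⟨F, hF, hFD⟩ := exists_vanishingIdeal_eq_span_hermitianPoly hq2 hD ha
      (r := k + 1) (s := 0) (by omega) heq hDc
    exact ⟨F, hF, totalDegree_hermitianPoly_ne_zero, hF.totalDegree_ne_zero (by omega), hFD⟩
  · right
    rw [hwk] at hlt hDc
    -- The Goppa bound of `a` is `k * (q + 1) + e + 1`, strictly below `μ * q`; this determines `a`.
    obtain ⟨e, he⟩ : ∃ e, wt q a + q + 1 = k * (q + 1) + (e + 1) + q ^ 2 :=
      ⟨wt q a + q + 1 - (k * (q + 1) + 1 + q ^ 2), by omega⟩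
    have hek : e + 1 + k < q := by nlinarith
    have hte : t ≤ e + 1 := by omega
    obtain ⟨u, rfl⟩ : ∃ u, q = e + 1 + u := ⟨q - (e + 1), by omega⟩
    have hae : a = expo u (k + e) := by
      refine eq_of_wt_eq ha.1 (by simp) ?_
      rw [wt_expo]
      zify at he ⊢
      linarith
    have hbox := card_boxes_le_ncard hq2 hD ha
    have ha0 : a 0 = u := by simp [hae]
    have ha1 : a 1 = k + e := by simp [hae]
    rw [ha0, ha1] at hbox
    -- The box inequality reduces to `(u - k) * e ≤ 0`, and `k < u`. Hence `t = 1` and the footprint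
    -- is the rectangle with `q` columns and `μ` rows.
    have he0 : e = 0 := by
      have h1 : (u + 1) * (k + e + 1) ≤ (k + 1) * (e + 1 + u) := by omega
      by_contra h0
      have h2 : 1 ≤ e := Nat.one_le_iff_ne_zero.2 h0
      have h3 : k + 1 ≤ u := by omega
      nlinarith
    subst he0
    refine ⟨by omega, ?_⟩
    have hfp := footprint_eq_boxes hq2 hD ha (by
      rw [ha0, ha1]
      exact hDc.trans ((show (k + 1) * (0 + 1 + u) = (u + 1) * (k + 0 + 1) by ring).le.trans
        (Nat.le_add_right _ _)))
    rw [ha0, ha1] at hfp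
    have himg : ∀ i j, expo i j ∈ footprint (0 + 1 + u) D ↔ i ≤ u ∧ j ≤ k := by
      intro i j
      rw [hfp]
      constructor
      · rintro ⟨p, hp, hpe⟩
        obtain rfl : p = (i, j) := expo_injective hpe
        simp only [boxes, Finset.coe_union, Finset.coe_product, Set.mem_union, Set.mem_prod,
          Finset.mem_coe, Finset.mem_range, Finset.mem_Ioc] at hp
        omega
      · intro hij
        refine ⟨(i, j), ?_, rfl⟩
        simp only [boxes, Finset.coe_union, Finset.coe_product, Set.mem_union, Set.mem_prod,
          Finset.mem_coe, Finset.mem_range, Finset.mem_Ioc]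
        omega
    obtain ⟨F₁, F₂, h₁, h₂, h₁₂⟩ := exists_vanishingIdeal_eq_span_pair (q := 0 + 1 + u) (D := D)
      (r := 0 + 1 + u) (s := k + 1) le_rfl (by rw [himg]; omega) (by rw [himg]; omega)
      (fun i j hi hj => by rw [himg]; omega)
    exact ⟨F₁, F₂, h₁, h₂, h₁.totalDegree_ne_zero (by omega), h₂.totalDegree_ne_zero (by omega),
      h₁₂⟩

theorem exists_of_delta_notMem_Lam {m : ℕ} (hq : 2 ≤ q) (hm : q ^ 2 ≤ m + q + 1)
    (hd : delta q m ∉ Lam q) : ∃ μ t : ℕ, 1 ≤ μ ∧ μ < q ∧ 1 ≤ t ∧ t + μ ≤ q ∧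
      delta q m = ((μ - 1) * (q + 1) + t : ℤ) ∧
      m + 1 + q + 1 = (μ - 1) * (q + 1) + t + q ^ 2 := by
  obtain ⟨d, hdm⟩ := Nat.exists_eq_add_of_le (show q ^ 2 ≤ m + q + 2 by omega)
  have hdelta : delta q m = d := by
    rw [delta]
    zify at hdm
    linear_combination hdm
  have hdiv := Nat.div_add_mod d q
  have hmod := Nat.mod_lt d (show 0 < q by omega)
  rw [hdelta] at hd ⊢
  have hcd : (d : ℤ) = (d / q : ℕ) * q + (d % q : ℕ) := by
    rw [mul_comm]
    exact_mod_cast hdiv.symm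
  rw [hcd, mem_Lam_iff (by positivity) (by exact_mod_cast hmod)] at hd
  have hlt : d / q < d % q := by omega
  generalize d / q = c at *
  generalize d % q = e at *
  obtain ⟨t, rfl⟩ := Nat.exists_eq_add_of_lt hlt
  -- A gap `c * q + e` has `c < e`, and it is rewritten as `c * (q + 1) + (e - c)`.
  refine ⟨c + 1, t + 1, by omega, by omega, by omega, by omega, ?_, ?_⟩
  · rw [hcd]
    push_cast
    ring
  · rw [Nat.add_sub_cancel]
    zify at hdm ⊢
    rw [hcd] at hdm
    push_cast at hdm
    linear_combination hdm

theorem exists_of_delta_mem_Lam {m : ℕ} (hm : q ^ 2 ≤ m + q + 1) (hd : delta q m ∈ Lam q) :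
    ∃ μ l : ℕ, μ ≤ q ∧ delta q m = (μ * q + l * (q + 1) : ℕ) ∧ 1 ≤ wt q (expo μ l) ∧
      m + 1 + q + 1 = wt q (expo μ l) + q ^ 2 := by
  obtain ⟨r, s, hr, hrs⟩ := exists_le_of_mem_Lam hd
  have h : m + 1 + q + 1 = wt q (expo r s) + q ^ 2 := by
    rw [delta] at hrs
    rw [wt_expo]
    zify
    linear_combination hrs
  exact ⟨r, s, hr, by rw [hrs]; push_cast; ring, by omega, h⟩

theorem IsMinimalSupport.isCompleteIntersection (hq : IsPrimePow q) (hK : Fintype.card K = q ^ 2)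
    (h : IsMinimalSupport q n D) (hn0 : 1 ≤ n) : IsCompleteIntersection D := by
  have hq2 := hq.two_le
  obtain ⟨n', hn', hnn, hmin⟩ := h.exists_mem_LamB hq2 hK
  obtain ⟨m, rfl⟩ : ∃ m, n' = m + 1 := ⟨n' - 1, by omega⟩
  rcases le_or_gt (m + 2) (q ^ 2) with hm | hm
  · obtain ⟨-, -, -, -, -, ⟨u, T, -, hI⟩ | ⟨-, u, v, T, -, -, hI⟩⟩ :=
      hmin.exists_lines hq hK hn' (by omega) (by omega)
    · exact ⟨_, _, hI⟩
    · exact ⟨_, _, hI⟩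
  have hm' : q ^ 2 ≤ m + q + 1 := by omega
  by_cases hd : delta q m ∈ Lam q
  · obtain ⟨μ, l, hμ, -, h1, h2⟩ := exists_of_delta_mem_Lam hm' hd
    obtain ⟨F, -, hF⟩ := hmin.exists_hermitianPoly hq hK hn' hμ h1 h2
    exact ⟨_, _, hF⟩
  · obtain ⟨μ, t, h1, h2, h3, h4, -, h5⟩ := exists_of_delta_notMem_Lam hq2 hm' hd
    rcases hmin.exists_of_gap hq hK h1 h2 h3 h4 h5 with ⟨F, -, hF⟩ | ⟨-, F₁, F₂, -, -, hF⟩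
    · exact ⟨_, _, hF⟩
    · exact ⟨_, _, hF⟩

end Minimal

end HermitianCode

open MvPolynomial HermitianCode in
theorem theoremA (q : ℕ) (hq : IsPrimePow q) (K : Type*) [Field K] [Fintype K] [DecidableEq K]
    (hK : Fintype.card K = q ^ 2) (m : ℕ) (c : Point q K → K)
    (hc : IsMinWeight (code q K m) c) :
    -- the support of `c` is a complete intersection
    IsCompleteIntersection (HermitianCode.support c) ∧
    -- description of the curves, for the codes labelled as usual
    (m + 1 ∈ LamB q →
      -- small `m`: a line and a union of lines
      (m + 2 ≤ q ^ 2 → ∃ h : ℕ, 1 ≤ h ∧ h < q ∧ h * q ≤ m + 1 ∧ m + 1 ≤ h * (q + 1) ∧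
        ((∃ (u : K) (T : Finset K), T.card = h + 1 ∧
            IsIntersection (HermitianCode.support c) (x K - C u) (∏ b ∈ T, (y K - C b))) ∨
          (m + 1 = h * q ∧ ∃ (u v : K) (T : Finset K), (u ≠ 0 ∨ v ≠ 0) ∧ T.card = h + 1 ∧
            IsIntersection (HermitianCode.support c) (y K - C u * x K - C v)
              (∏ a ∈ T, (x K - C a))))) ∧
      -- larger `m` with `δ(m)` in the semigroup: the Hermitian curve and one further curve
      (q ^ 2 ≤ m + q + 1 → delta q m ∈ Lam q →
        ∃ μ l : ℕ, μ ≤ q ∧ delta q m = (μ * q + l * (q + 1) : ℕ) ∧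
          ∃ F : MvPolynomial (Fin 2) K, HasLeadingMonomial F μ l ∧
            IsIntersection (HermitianCode.support c) (hermitianPoly q K) F) ∧
      -- larger `m` with `δ(m)` not in the semigroup
      (q ^ 2 ≤ m + q + 1 → delta q m ∉ Lam q →
        ∃ μ t : ℕ, 1 ≤ μ ∧ μ < q ∧ 1 ≤ t ∧ t + μ ≤ q ∧
          delta q m = ((μ - 1) * (q + 1) + t : ℤ) ∧
          ((∃ F : MvPolynomial (Fin 2) K, HasLeadingMonomial F μ 0 ∧
              IsIntersection (HermitianCode.support c) (hermitianPoly q K) F) ∨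
            (t = 1 ∧ ∃ F₁ F₂ : MvPolynomial (Fin 2) K,
              HasLeadingMonomial F₁ q 0 ∧ HasLeadingMonomial F₂ 0 μ ∧
              IsIntersection (HermitianCode.support c) F₁ F₂)))) := by
  have hq2 := hq.two_le
  have h := hc.isMinimalSupport hq2
  refine ⟨h.isCompleteIntersection hq hK (by omega), fun hm => ⟨fun hmq => ?_, fun hmq hd => ?_,
    fun hmq hd => ?_⟩⟩
  · exact h.exists_lines hq hK hm (by omega) (by omega)
  · obtain ⟨μ, l, hμ, hdel, h1, h2⟩ := exists_of_delta_mem_Lam hmq hd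
    exact ⟨μ, l, hμ, hdel, h.exists_hermitianPoly hq hK hm hμ h1 h2⟩
  · obtain ⟨μ, t, h1, h2, h3, h4, hdel, h5⟩ := exists_of_delta_notMem_Lam hq2 hmq hd
    exact ⟨μ, t, h1, h2, h3, h4, hdel, h.exists_of_gap hq hK h1 h2 h3 h4 h5⟩
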